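/- Let $A\in\mathbb C^{n\times n}$ be banded with upper bandwidth $\beta$ and lower bandwidth $\gamma$, where $\beta,\gamma\ge 1$ are integers; that is, $(A)_{k,\ell}=0$ whenever $\ell-k>\beta$ or $k-\ell>\gamma$. Let $W(A)=\{\mathbf v^*A\mathbf v:\mathbf v\in\mathbb C^n,\ \|\mathbf v\|_2=1\}$ be its field of values. Suppose that $W(A)\subseteq E$, where $E\subset\{z\in\mathbb C:\operatorname{Re} z>0\}$ is a closed set whose boundary is the horizontal ellipse $$\left\{z\in\mathbb C:\ \frac{(\operatorname{Re}(z-c))^2}{a^2}+\frac{(\operatorname{Im}(z-c))^2}{b^2}=1\right\}$$ with semi-axes $a\ge b>0$ and center $c\in\mathbb C$. All square roots of complex numbers are principal square roots. Let $$e^{-\sqrt A}=\frac1{2\pi i}\int_\Gamma e^{-\sqrt z}\,(zI-A)^{-1}\,dz ,$$ where $\Gamma$ is a finite system of closed piecewise $C^1$ curves in $\mathbb C\setminus(-\infty,0]$ that avoids the eigenvalues of $A$, has total winding number $1$ around each eigenvalue of $A$, and has total winding number $0$ around each point of $(-\infty,0]$ (the bound below holds for every such $\Gamma$). For $1\le k,\ell\le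 n$ let $$\xi=\begin{cases}\lceil(\ell-k)/\beta\rceil,& k<\ell,\\ \lceil(k-\ell)/\gamma\rceil,& k\ge\ell.\end{cases}$$ Then, for all $1\le k,\ell\le n$, $$\left|\left(e^{-\sqrt A}\right)_{k,\ell}\right|\ \le\ 2\,q_2(a,b,c,0)\left(\frac{a+b}{|c|}\cdot\frac1{\left|1+\sqrt{1-(a^2-b^2)/c^2}\right|}\right)^{\xi},$$ where $$q_2(a,b,c,\varepsilon)=\frac{\left|c(1-\varepsilon/|c|)+\sqrt{c^2(1-\varepsilon/|c|)^2-(a^2-b^2)}\right|}{\left|c(1-\varepsilon/|c|)+\sqrt{c^2(1-\varepsilon/|c|)^2-(a^2-b^2)}\right|-(a+b)} .$$ -/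

import Mathlib

/-- `A` lies in the class of `n × n` complex banded matrices with upper bandwidth `β` and
lower bandwidth `γ`. -/
def IsBanded {n : ℕ} (β γ : ℕ) (A : Matrix (Fin n) (Fin n) ℂ) : Prop :=
  ∀ k l : Fin n, ((β : ℤ) < (l : ℤ) - (k : ℤ) ∨ (γ : ℤ) < (k : ℤ) - (l : ℤ)) → A k l = 0

/-- The exponent `ξ` attached to the position `(k, l)`: it is `⌈(l - k) / β⌉` above the diagonal
and `⌈(k - l) / γ⌉` on and below the diagonal. Only the difference of the indices matters, so
counting them from `0` or from `1` makes no difference. -/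
noncomputable def bandExponent {n : ℕ} (β γ : ℕ) (k l : Fin n) : ℕ :=
  if k < l then ⌈((l : ℝ) - (k : ℝ)) / (β : ℝ)⌉₊ else ⌈((k : ℝ) - (l : ℝ)) / (γ : ℝ)⌉₊

/-- The field of values `{v* A v : ‖v‖ = 1}`, with the Euclidean norm on `ℂⁿ`. -/
def fieldOfValues {n : ℕ} (A : Matrix (Fin n) (Fin n) ℂ) : Set ℂ :=
  {w | ∃ v : EuclideanSpace ℂ (Fin n), ‖v‖ = 1 ∧ w = star v.ofLp ⬝ᵥ (A.mulVec v.ofLp)}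

/-- The horizontal ellipse (the curve) with centre `c`, semi-axis `a` in the real direction and
semi-axis `b` in the imaginary direction. -/
def ellipseCurve (a b : ℝ) (c : ℂ) : Set ℂ :=
  {z | ((z.re - c.re) / a) ^ 2 + ((z.im - c.im) / b) ^ 2 = 1}

/-- A path in `ℂ`, parametrized by `[0, 1]`, that is piecewise continuously differentiable:
`[0, 1]` is divided into finitely many closed intervals on each of which it is `C¹`. -/
def IsPiecewiseC1 {x y : ℂ} (p : Path x y) : Prop :=
  ∃ (m : ℕ) (s : ℕ → ℝ), s 0 = 0 ∧ s m = 1 ∧ Monotone s ∧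
    ∀ j < m, ContDiffOn ℝ 1 p.extend (Set.Icc (s j) (s (j + 1)))

/-- The complex line integral `∫_p f(z) dz`. -/
noncomputable def lineIntegral {x y : ℂ} (f : ℂ → ℂ) (p : Path x y) : ℂ :=
  curveIntegral (fun z : ℂ => ContinuousLinearMap.toSpanSingleton ℂ (f z)) p

/-- A contour in `Ω` around the spectrum of `A`: a finite system of closed piecewise `C¹` curves
in `Ω` avoiding the spectrum, that encircles each eigenvalue of `A` exactly once in the positive
sense (total winding number `1`) and encircles no point outside `Ω` (total winding number `0`).
Systems of positively oriented Jordan curves enclosing the spectrum are the typical case. -/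
structure Contour {n : ℕ} (Ω : Set ℂ) (A : Matrix (Fin n) (Fin n) ℂ) where
  /-- the number of closed curves -/
  num : ℕ
  /-- the base points -/
  base : Fin num → ℂ
  /-- the closed curves -/
  curve : (i : Fin num) → Path (base i) (base i)
  piecewiseC1 : ∀ i, IsPiecewiseC1 (curve i)
  mem : ∀ i t, curve i t ∈ Ω
  avoids : ∀ i t, curve i t ∉ spectrum ℂ A
  winding_eigenvalue : ∀ w ∈ spectrum ℂ A,
    (2 * Real.pi * Complex.I)⁻¹ * ∑ i, lineIntegral (fun z => (z - w)⁻¹) (curve i) = 1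
  winding_outside : ∀ w, w ∉ Ω →
    (2 * Real.pi * Complex.I)⁻¹ * ∑ i, lineIntegral (fun z => (z - w)⁻¹) (curve i) = 0

/-- The matrix function `f(A) = (2πi)⁻¹ ∫_Γ f(z) (zI - A)⁻¹ dz`, integrated entrywise, for `f`
analytic on `Ω` and a contour `Γ` in `Ω` around the spectrum of `A`. -/
noncomputable def matrixFunction {n : ℕ} {Ω : Set ℂ} (f : ℂ → ℂ) (A : Matrix (Fin n) (Fin n) ℂ)
    (Γ : Contour Ω A) : Matrix (Fin n) (Fin n) ℂ :=
  Matrix.of fun k l => (2 * Real.pi * Complex.I)⁻¹ *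
    ∑ i, lineIntegral
      (fun z => f z * ((z • (1 : Matrix (Fin n) (Fin n) ℂ) - A)⁻¹) k l) (Γ.curve i)

/-- The function `z ↦ e^{-√z}` with the principal square root; it is analytic on
`Complex.slitPlane`, the plane without `(-∞, 0]`. -/
noncomputable def expNegSqrt (z : ℂ) : ℂ := Complex.exp (-Complex.sqrt z)

/-- The number `|c(1 - ε/|c|) + √(c²(1 - ε/|c|)² - (a² - b²))|` (principal square root). -/
noncomputable def q2Modulus (a b : ℝ) (c : ℂ) (ε : ℝ) : ℝ :=
  ‖c * (1 - (ε : ℂ) / (‖c‖ : ℂ)) +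
    Complex.sqrt (c ^ 2 * (1 - (ε : ℂ) / (‖c‖ : ℂ)) ^ 2 - ((a : ℂ) ^ 2 - (b : ℂ) ^ 2))‖

/-- The prefactor `q₂(a, b, c, ε)`. -/
noncomputable def q2 (a b : ℝ) (c : ℂ) (ε : ℝ) : ℝ :=
  q2Modulus a b c ε / (q2Modulus a b c ε - (a + b))

/-! ### Cauchy's theorem in the slit plane, by primitives and partial fractions -/

section

open Complex Metric Set

/-! Put α = (a+b)/2, δ = (a-b)/2 and ψ(w) = c + αw + δ/w. The map ψ sends the unit circle to the
boundary ellipse of E and larger circles to confocal ellipses. Let τ (`originRadius`) be the larger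
modulus of a root of ψ(w) = 0. For 1 < r < τ the image of |w| = r surrounds the spectrum and avoids
(-∞, 0], so Cauchy's theorem replaces Γ by this ellipse (`matrixFunction_apply_eq_ellipseIntegral`,
`joukowski_mem_slitPlane`). Since |e^{-√z}| ≤ 1, only the entries of ψ'(w)(ψ(w)I - A)⁻¹ remain to be
bounded.

With x = 1/w this matrix is x P(x), where P(x) = (α - δx²) N(x)⁻¹ and N(x) = (α + δx²)I - x(A - cI).
Because W(A) lies inside the ellipse, P is holomorphic in the unit disc with nonnegative Hermitian
part (`re_support_pos`, `re_inv_joukowskiPencil_nonneg`), and P(0) = I. Expanding N(x)⁻¹ in powers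
of A - cI, whose (k,l) entries vanish below the exponent ξ, shows that P_{kl} has a zero of order at
least ξ at 0. An off-diagonal Carathéodory estimate (`norm_le_of_norm_add_conj_le`) then gives
|P_{kl}(x)| ≤ 2|x|^ξ/(1 - |x|).

Integration over |w| = r gives 2 r^{-ξ}/(1 - 1/r), and r tends to τ. The base of the claimed power
is 1/τ, and q₂ = 1/(1 - 1/τ). -/

/-- A holomorphic function on the slit plane has a primitive there. -/
theorem exists_primitive_slitPlane {f : ℂ → ℂ} (hf : DifferentiableOn ℂ f slitPlane) :
    ∃ F : ℂ → ℂ, ∀ z ∈ slitPlane, HasDerivAt F (f z) z := by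
  have hconv : Convex ℝ {z : ℂ | 0 < z.re} := convex_halfSpace_re_gt 0
  have hopen : IsOpen {z : ℂ | 0 < z.re} := isOpen_lt continuous_const continuous_re
  have hsq : ∀ w : ℂ, 0 < w.re → w ^ 2 ∈ slitPlane := by
    intro w hw
    rw [mem_slitPlane_iff]
    by_cases hi : w.im = 0
    · left
      simp [pow_two, hi, hw]
    · right
      simp only [pow_two, mul_im]
      intro h
      apply hi
      have : w.re * w.im = 0 := by linarith
      rcases mul_eq_zero.1 this with h | h
      · linarith
      · exact h
  -- Squaring maps the right half-plane onto the slit plane. The half-plane is convex, so the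
  -- pulled-back form f(w²) 2w dw has a primitive there, which is carried back by the principal root
  -- exp(log z / 2).
  have hd : DifferentiableOn ℂ (fun w : ℂ => f (w ^ 2) * (2 * w)) {z : ℂ | 0 < z.re} := by
    refine DifferentiableOn.mul ?_ (by fun_prop)
    exact hf.comp (by fun_prop) hsq
  obtain ⟨G, hG⟩ := hconv.exists_forall_hasDerivWithinAt hd
  refine ⟨fun z => G (exp (log z / 2)), fun z hz => ?_⟩
  have hz0 : z ≠ 0 := slitPlane_ne_zero hz
  have hre : 0 < (exp (log z / 2)).re := by
    rw [exp_re]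
    have him : (log z / 2).im = z.arg / 2 := by
      rw [div_ofNat_im, log_im]
    rw [him]
    refine mul_pos (Real.exp_pos _) (Real.cos_pos_of_mem_Ioo ⟨?_, ?_⟩)
    · linarith [neg_pi_lt_arg z]
    · have := (arg_le_pi z).lt_of_ne (mem_slitPlane_iff_arg.1 hz).1
      linarith
  have hsqz : exp (log z / 2) ^ 2 = z := by
    rw [← exp_nat_mul]
    rw [show ((2 : ℕ) : ℂ) * (log z / 2) = log z by push_cast; ring, exp_log hz0]
  have h1 : HasDerivAt (fun z => exp (log z / 2)) (exp (log z / 2) * (z⁻¹ / 2)) z :=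
    ((hasDerivAt_log hz).div_const 2).cexp
  have h2 := ((hG _ hre).hasDerivAt (hopen.mem_nhds hre)).comp z h1
  refine h2.congr_deriv ?_
  rw [hsqz]
  have : f z * (2 * exp (log z / 2)) * (exp (log z / 2) * (z⁻¹ / 2))
      = f z * (exp (log z / 2) ^ 2 * z⁻¹) := by ring
  rw [this, hsqz, mul_inv_cancel₀ hz0, mul_one]

/-- A linear functional on the continuous functions on `Ω \ σ` that behaves like integration over
a cycle in `Ω \ σ` that winds around no point of `σ`. -/
structure IsNullCycle (Ω σ : Set ℂ) (L : (ℂ → ℂ) → ℂ) : Prop where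
  congr : ∀ {g h : ℂ → ℂ}, EqOn g h (Ω \ σ) → L g = L h
  add : ∀ {g h : ℂ → ℂ}, ContinuousOn g (Ω \ σ) → ContinuousOn h (Ω \ σ) →
    L (fun z => g z + h z) = L g + L h
  smul : ∀ (r : ℂ) {g : ℂ → ℂ}, ContinuousOn g (Ω \ σ) → L (fun z => r * g z) = r * L g
  exact : ∀ {g F : ℂ → ℂ}, ContinuousOn g (Ω \ σ) → (∀ z ∈ Ω \ σ, HasDerivAt F (g z) z) → L g = 0
  inv_sub : ∀ w ∈ σ, L (fun z => (z - w)⁻¹) = 0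

namespace IsNullCycle

variable {Ω σ : Set ℂ} {L : (ℂ → ℂ) → ℂ}

theorem prod_sub_ne_zero {S : Multiset ℂ} (hS : ∀ s ∈ S, s ∈ σ) {z : ℂ} (hz : z ∈ Ω \ σ) :
    (S.map fun s => z - s).prod ≠ 0 := by
  intro h
  rw [Multiset.prod_eq_zero_iff, Multiset.mem_map] at h
  obtain ⟨s, hs, h⟩ := h
  rw [sub_eq_zero] at h
  exact hz.2 (h ▸ hS s hs)

theorem continuous_prod_sub (S : Multiset ℂ) :
    Continuous fun z : ℂ => (S.map fun s => z - s).prod := by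
  induction S using Multiset.induction_on with
  | empty => simpa using continuous_const
  | cons a S ih => 
    simp only [Multiset.map_cons, Multiset.prod_cons]
    exact (continuous_id.sub continuous_const).mul ih

theorem continuousOn_inv_prod {S : Multiset ℂ} (hS : ∀ s ∈ S, s ∈ σ) :
    ContinuousOn (fun z : ℂ => ((S.map fun s => z - s).prod)⁻¹) (Ω \ σ) :=
  (continuous_prod_sub S).continuousOn.inv₀ fun _ hz => prod_sub_ne_zero hS hz

/-- Partial fractions by strong induction on the number of factors: two distinct poles are split,
while a single repeated pole gives either (z - a)⁻¹ or a function with a primitive. -/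
theorem inv_prod (hL : IsNullCycle Ω σ L) (S : Multiset ℂ) (hS : ∀ s ∈ S, s ∈ σ) :
    L (fun z => ((S.map fun s => z - s).prod)⁻¹) = 0 := by
  induction hn : S.card using Nat.strong_induction_on generalizing S with
  | _ n ih =>
  rcases S.empty_or_exists_mem with rfl | ⟨a, ha⟩
  · have : L (fun _ => (1 : ℂ)) = 0 :=
      hL.exact (F := fun z => z) continuousOn_const fun z _ => hasDerivAt_id z
    simpa using this
  obtain ⟨T, rfl⟩ := Multiset.exists_cons_of_mem ha
  have haσ := hS a ha
  by_cases hT : ∃ m ∈ T, m ≠ a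
  · obtain ⟨m, hm, hma⟩ := hT
    obtain ⟨T', rfl⟩ := Multiset.exists_cons_of_mem hm
    have h1 : ∀ s ∈ a ::ₘ T', s ∈ σ := by
      intro s hs; apply hS; simp only [Multiset.mem_cons] at hs ⊢; tauto
    have h2 : ∀ s ∈ m ::ₘ T', s ∈ σ := by
      intro s hs; apply hS; simp only [Multiset.mem_cons] at hs ⊢; tauto
    have hcard : T'.card + 1 < n := by rw [← hn]; simp
    have e1 := ih _ hcard _ h1 (by simp)
    have e2 := ih _ hcard _ h2 (by simp)
    have key : L (fun z => (((a ::ₘ m ::ₘ T').map fun s => z - s).prod)⁻¹)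
        = L (fun z => (a - m)⁻¹ * (((a ::ₘ T').map fun s => z - s).prod)⁻¹
          + (-(a - m)⁻¹) * (((m ::ₘ T').map fun s => z - s).prod)⁻¹) := by
      refine hL.congr fun z hz => ?_
      have n1 := prod_sub_ne_zero hS hz
      simp only [Multiset.map_cons, Multiset.prod_cons] at n1 ⊢
      have n2 : z - a ≠ 0 := left_ne_zero_of_mul n1
      have n3 : z - m ≠ 0 := left_ne_zero_of_mul (right_ne_zero_of_mul n1)
      have n4 : (T'.map fun s => z - s).prod ≠ 0 :=
        right_ne_zero_of_mul (right_ne_zero_of_mul n1)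
      have n5 : a - m ≠ 0 := sub_ne_zero.2 hma.symm
      field_simp
      ring
    rw [key, hL.add (continuousOn_const.fun_mul (continuousOn_inv_prod h1))
      (continuousOn_const.fun_mul (continuousOn_inv_prod h2)), hL.smul _ (continuousOn_inv_prod h1),
      hL.smul _ (continuousOn_inv_prod h2), e1, e2]
    simp
  · push Not at hT
    obtain ⟨k, rfl⟩ : ∃ k, T = Multiset.replicate k a := ⟨_, Multiset.eq_replicate_of_mem hT⟩
    rcases Nat.eq_zero_or_pos k with rfl | hk
    · simpa using hL.inv_sub a haσ
    -- The pole has order k + 1 ≥ 2, so the primitive carries the power k.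
    · refine hL.exact (F := fun z => -(k : ℂ)⁻¹ * ((z - a) ^ k)⁻¹) (continuousOn_inv_prod hS)
        fun z hz => ?_
      have hza : z - a ≠ 0 := by
        intro h
        exact hz.2 (by rw [sub_eq_zero.1 h]; exact haσ)
      have hk' : (k : ℂ) ≠ 0 := by exact_mod_cast hk.ne'
      have hd := ((((hasDerivAt_id z).sub_const a).fun_pow k).fun_inv (pow_ne_zero k hza)).const_mul
        (-(k : ℂ)⁻¹)
      refine hd.congr_deriv ?_
      obtain ⟨j, rfl⟩ := Nat.exists_eq_succ_of_ne_zero hk.ne'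
      simp only [id, Nat.succ_eq_add_one, Multiset.map_cons, Multiset.map_replicate,
        Multiset.prod_cons, Multiset.prod_replicate, Nat.add_sub_cancel]
      field_simp
      ring

/-- Writing f(z) = f(a) + (z - a) g(z) with g = `dslope f a` removes one factor from the
denominator. The induction ends at a holomorphic function, which has a primitive on the slit plane.
-/
theorem div_prod (hL : IsNullCycle slitPlane σ L) (hσ : σ ⊆ slitPlane) {f : ℂ → ℂ}
    (hf : DifferentiableOn ℂ f slitPlane) (S : Multiset ℂ) (hS : ∀ s ∈ S, s ∈ σ) :
    L (fun z => f z * ((S.map fun s => z - s).prod)⁻¹) = 0 := by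
  induction S using Multiset.induction_on generalizing f with
  | empty =>
    obtain ⟨F, hF⟩ := exists_primitive_slitPlane hf
    have : L f = 0 := hL.exact (hf.continuousOn.mono sdiff_subset) fun z hz => hF z hz.1
    simpa using this
  | cons a S ih =>
    have ha := hσ (hS a (by simp))
    have hS' : ∀ s ∈ S, s ∈ σ := fun s hs => hS s (by simp [hs])
    have hg : DifferentiableOn ℂ (dslope f a) slitPlane :=
      (differentiableOn_dslope (isOpen_slitPlane.mem_nhds ha)).2 hf
    have key : L (fun z => f z * (((a ::ₘ S).map fun s => z - s).prod)⁻¹)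
        = L (fun z => f a * (((a ::ₘ S).map fun s => z - s).prod)⁻¹
          + dslope f a z * ((S.map fun s => z - s).prod)⁻¹) := by
      refine hL.congr fun z hz => ?_
      have n1 := prod_sub_ne_zero hS hz
      simp only [Multiset.map_cons, Multiset.prod_cons] at n1 ⊢
      have n2 : z - a ≠ 0 := left_ne_zero_of_mul n1
      have n3 : (S.map fun s => z - s).prod ≠ 0 := right_ne_zero_of_mul n1
      have hfz : f z = f a + (z - a) * dslope f a z := by
        have := sub_smul_dslope f a z
        rw [smul_eq_mul] at this
        rw [this]; ring
      rw [hfz]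
      field_simp
    rw [key, hL.add (continuousOn_const.fun_mul (continuousOn_inv_prod hS))
      ((hg.continuousOn.mono sdiff_subset).fun_mul (continuousOn_inv_prod hS')),
      hL.smul _ (continuousOn_inv_prod hS), hL.inv_prod _ hS, ih hg hS']
    simp

end IsNullCycle

end

/-! ### Line integrals along piecewise C¹ paths -/

section

open Complex Metric Set MeasureTheory unitInterval

section LineIntegral

variable {x y : ℂ} {p : Path x y} {f g : ℂ → ℂ} {s : Set ℂ}

theorem lineIntegral_eq (f : ℂ → ℂ) (p : Path x y) :
    lineIntegral f p = ∫ t in (0 : ℝ)..1, deriv p.extend t * f (p.extend t) := by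
  rw [lineIntegral, curveIntegral_eq_intervalIntegral_deriv]
  simp only [ContinuousLinearMap.toSpanSingleton_apply, smul_eq_mul]

theorem extend_mem (hs : ∀ t, p t ∈ s) (t : ℝ) : p.extend t ∈ s :=
  hs (projIcc 0 1 zero_le_one t)

theorem IsPiecewiseC1.intervalIntegrable (hp : IsPiecewiseC1 p) (hf : ContinuousOn f s)
    (hs : ∀ t, p t ∈ s) :
    IntervalIntegrable (fun t => deriv p.extend t * f (p.extend t)) volume 0 1 := by
  obtain ⟨m, u, hu0, hum, hu, hC⟩ := hp
  rw [← hu0, ← hum]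
  refine IntervalIntegrable.trans_iterate fun j hj => ?_
  have hle : u j ≤ u (j + 1) := hu j.le_succ
  rcases hle.eq_or_lt with he | hlt
  · rw [← he]
  have hcont : ContinuousOn (fun t => derivWithin p.extend (Icc (u j) (u (j + 1))) t
      * f (p.extend t)) (Icc (u j) (u (j + 1))) := by
    refine ((hC j hj).continuousOn_derivWithin (uniqueDiffOn_Icc hlt) le_rfl).mul ?_
    refine hf.comp p.continuous_extend.continuousOn fun t _ => extend_mem hs t
  have hint := hcont.intervalIntegrable_of_Icc (μ := volume) hle
  refine hint.congr_ae ?_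
  rw [uIoc_of_le hle, ← restrict_Ioo_eq_restrict_Ioc]
  filter_upwards [ae_restrict_mem measurableSet_Ioo] with t ht
  rw [derivWithin_of_mem_nhds (Icc_mem_nhds ht.1 ht.2)]

theorem lineIntegral_add (hp : IsPiecewiseC1 p) (hs : ∀ t, p t ∈ s) (hf : ContinuousOn f s)
    (hg : ContinuousOn g s) :
    lineIntegral (fun z => f z + g z) p = lineIntegral f p + lineIntegral g p := by
  simp only [lineIntegral_eq]
  rw [← intervalIntegral.integral_add (hp.intervalIntegrable hf hs) (hp.intervalIntegrable hg hs)]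
  simp only [mul_add]

theorem lineIntegral_const_mul (r : ℂ) (f : ℂ → ℂ) (p : Path x y) :
    lineIntegral (fun z => r * f z) p = r * lineIntegral f p := by
  simp only [lineIntegral_eq]
  rw [← intervalIntegral.integral_const_mul]
  congr 1; ext t; ring

theorem lineIntegral_congr (hs : ∀ t, p t ∈ s) (h : EqOn f g s) :
    lineIntegral f p = lineIntegral g p := by
  simp only [lineIntegral_eq]
  congr 1; ext t
  rw [h (extend_mem hs t)]

theorem IsPiecewiseC1.differentiableAt (hp : IsPiecewiseC1 p) :
    ∃ N : Set ℝ, N.Countable ∧ ∀ t ∈ Ioo (0 : ℝ) 1 \ N, DifferentiableAt ℝ p.extend t := by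
  obtain ⟨m, u, hu0, hum, hu, hC⟩ := hp
  refine ⟨range u, countable_range u, fun t ht => ?_⟩
  -- The first breakpoint beyond t locates the open piece that contains t.
  have hex : ∃ j, t < u j := ⟨m, hum ▸ ht.1.2⟩
  classical
  let j := Nat.find hex
  have hj : t < u j := Nat.find_spec hex
  have hj0 : j ≠ 0 := by
    intro h
    rw [h, hu0] at hj
    exact lt_asymm hj ht.1.1
  obtain ⟨i, hi⟩ := Nat.exists_eq_succ_of_ne_zero hj0
  have hi1 : u i < t := by
    have := Nat.find_min hex (m := i) (by change i < j; omega)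
    exact lt_of_le_of_ne (not_lt.1 this) fun h => ht.2 ⟨i, h⟩
  have hi2 : t < u (i + 1) := by rw [hi] at hj; exact hj
  have him : i < m := by
    by_contra h
    have := hu (not_lt.1 h)
    rw [hum] at this
    linarith [ht.1.2]
  exact ((hC i him).differentiableOn one_ne_zero).differentiableAt (Icc_mem_nhds hi1 hi2)

theorem lineIntegral_eq_sub {F : ℂ → ℂ} (hp : IsPiecewiseC1 p) (hs : ∀ t, p t ∈ s)
    (hf : ContinuousOn f s) (hF : ∀ z ∈ s, HasDerivAt F (f z) z) :
    lineIntegral f p = F y - F x := by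
  obtain ⟨N, hN, hd⟩ := hp.differentiableAt
  rw [lineIntegral_eq, integral_eq_of_hasDerivAt_off_countable_of_le (fun t => F (p.extend t)) _
    zero_le_one hN ?_ ?_ (hp.intervalIntegrable hf hs)]
  · simp
  · intro t _
    exact ((hF _ (extend_mem hs t)).continuousAt.comp
      p.continuous_extend.continuousAt).continuousWithinAt
  · intro t ht
    have := (hF _ (extend_mem hs t)).scomp t (hd t ht).hasDerivAt
    simpa [Function.comp_def] using this

end LineIntegral

end

/-! ### Integrals over Joukowski ellipses and the change of contour -/

section

open Complex Metric Set MeasureTheory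

/-- The Joukowski-type map `w ↦ c + α w + δ / w`. It maps the circles around `0` to confocal
ellipses with centre `c`. -/
noncomputable def joukowski (α δ : ℝ) (c w : ℂ) : ℂ := c + α * w + δ / w

theorem hasDerivAt_joukowski (α δ : ℝ) (c : ℂ) {w : ℂ} (hw : w ≠ 0) :
    HasDerivAt (joukowski α δ c) (α - δ / w ^ 2) w := by
  have h := (((hasDerivAt_id w).const_mul (α : ℂ)).const_add c).fun_add
    ((hasDerivAt_inv hw).const_mul (δ : ℂ))
  refine (h.congr_deriv ?_).congr_of_eventuallyEq (Filter.Eventually.of_forall fun x => ?_)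
  · field_simp
    ring
  · simp [joukowski, div_eq_mul_inv]

/-- `(2πi)⁻¹` times the integral of `g` over the image of the circle of radius `r` around `0`
under the Joukowski map. -/
noncomputable def ellipseIntegral (α δ : ℝ) (c : ℂ) (r : ℝ) (g : ℂ → ℂ) : ℂ :=
  (2 * Real.pi * I)⁻¹ * ∮ w in C(0, r), g (joukowski α δ c w) * (α - δ / w ^ 2)

/-- `(2πi)⁻¹` times the integral of `g` over a contour. -/
noncomputable def Contour.integral {n : ℕ} {Ω : Set ℂ} {A : Matrix (Fin n) (Fin n) ℂ}
    (Γ : Contour Ω A) (g : ℂ → ℂ) : ℂ :=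
  (2 * Real.pi * I)⁻¹ * ∑ i, lineIntegral g (Γ.curve i)

section Ellipse

variable {α δ r : ℝ} {c : ℂ} {U : Set ℂ} {g h : ℂ → ℂ}

theorem sphere_zero_ne_zero (hr : 0 < r) {w : ℂ} (hw : w ∈ sphere (0 : ℂ) r) : w ≠ 0 := by
  rintro rfl
  simp at hw
  exact hr.ne hw

theorem continuousOn_ellipseIntegrand (hr : 0 < r)
    (hU : ∀ w ∈ sphere (0 : ℂ) r, joukowski α δ c w ∈ U) (hg : ContinuousOn g U) :
    ContinuousOn (fun w => g (joukowski α δ c w) * (α - δ / w ^ 2)) (sphere 0 r) := by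
  refine ContinuousOn.mul (hg.comp (fun w hw => ?_) hU) ?_
  · exact (hasDerivAt_joukowski α δ c
      (sphere_zero_ne_zero hr hw)).continuousAt.continuousWithinAt
  · exact continuousOn_const.sub (continuousOn_const.div (by fun_prop)
      fun w hw => pow_ne_zero 2 (sphere_zero_ne_zero hr hw))

theorem circleIntegrable_ellipseIntegrand (hr : 0 < r)
    (hU : ∀ w ∈ sphere (0 : ℂ) r, joukowski α δ c w ∈ U) (hg : ContinuousOn g U) :
    CircleIntegrable (fun w => g (joukowski α δ c w) * (α - δ / w ^ 2)) 0 r :=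
  (continuousOn_ellipseIntegrand hr hU hg).circleIntegrable hr.le

theorem ellipseIntegral_add (hr : 0 < r)
    (hU : ∀ w ∈ sphere (0 : ℂ) r, joukowski α δ c w ∈ U) (hg : ContinuousOn g U)
    (hh : ContinuousOn h U) :
    ellipseIntegral α δ c r (fun z => g z + h z)
      = ellipseIntegral α δ c r g + ellipseIntegral α δ c r h := by
  simp only [ellipseIntegral, add_mul]
  rw [circleIntegral.integral_add (circleIntegrable_ellipseIntegrand hr hU hg)
    (circleIntegrable_ellipseIntegrand hr hU hh), mul_add]

theorem ellipseIntegral_const_mul (s : ℂ) :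
    ellipseIntegral α δ c r (fun z => s * g z) = s * ellipseIntegral α δ c r g := by
  simp only [ellipseIntegral, mul_assoc, circleIntegral.integral_const_mul]
  ring

theorem ellipseIntegral_congr (hr : 0 < r)
    (hU : ∀ w ∈ sphere (0 : ℂ) r, joukowski α δ c w ∈ U) (hgh : EqOn g h U) :
    ellipseIntegral α δ c r g = ellipseIntegral α δ c r h := by
  rw [ellipseIntegral, ellipseIntegral]
  congr 1
  refine circleIntegral.integral_congr hr.le fun w hw => ?_
  simp only [hgh (hU w hw)]

theorem ellipseIntegral_eq_zero (hr : 0 < r)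
    (hU : ∀ w ∈ sphere (0 : ℂ) r, joukowski α δ c w ∈ U) {F : ℂ → ℂ}
    (hF : ∀ z ∈ U, HasDerivAt F (g z) z) : ellipseIntegral α δ c r g = 0 := by
  rw [ellipseIntegral, circleIntegral.integral_eq_zero_of_hasDerivWithinAt
    (f := fun w => F (joukowski α δ c w)) hr.le, mul_zero]
  intro w hw
  exact ((hF _ (hU w hw)).comp w
    (hasDerivAt_joukowski α δ c (sphere_zero_ne_zero hr hw))).hasDerivWithinAt

theorem exists_quadratic_factorization {p q s : ℂ} (hp : p ≠ 0) :
    ∃ u v : ℂ, ∀ w, p * w ^ 2 + q * w + s = p * (w - u) * (w - v) := by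
  obtain ⟨t, ht⟩ := IsAlgClosed.exists_pow_nat_eq (q ^ 2 - 4 * p * s) (n := 2) (by norm_num)
  refine ⟨(-q + t) / (2 * p), (-q - t) / (2 * p), fun w => ?_⟩
  field_simp
  linear_combination ht

/-- Since ψ(w) - z = α(w - u)(w - v)/w, the integrand is the logarithmic derivative 1/(w-u) +
1/(w-v) - 1/w. All three poles lie in the disc, so the count is 1 + 1 - 1. -/
theorem ellipseIntegral_inv_sub (hr : 0 < r) (hα : α ≠ 0) {z : ℂ}
    (hz : ∀ w : ℂ, w ≠ 0 → joukowski α δ c w = z → ‖w‖ < r) :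
    ellipseIntegral α δ c r (fun x => (x - z)⁻¹) = 1 := by
  have hα' : (α : ℂ) ≠ 0 := by exact_mod_cast hα
  obtain ⟨u, v, huv⟩ := exists_quadratic_factorization (q := c - z) (s := δ) hα'
  have hroot : ∀ w : ℂ, α * w ^ 2 + (c - z) * w + δ = 0 → w ∈ ball (0 : ℂ) r := by
    intro w hw
    rw [mem_ball_zero_iff]
    -- Zero is a root of the quadratic when δ = 0; it lies in the disc trivially.
    by_cases hw0 : w = 0
    · simpa [hw0] using hr
    refine hz w hw0 ?_
    rw [joukowski]
    field_simp
    linear_combination hw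
  have hu := hroot u (by rw [huv]; ring)
  have hv := hroot v (by rw [huv]; ring)
  have h0 : (0 : ℂ) ∈ ball (0 : ℂ) r := mem_ball_self hr
  have hint : ∀ {y : ℂ}, y ∈ ball (0 : ℂ) r → CircleIntegrable (fun w => (w - y)⁻¹) 0 r := by
    intro y hy
    refine ContinuousOn.circleIntegrable hr.le ?_
    refine ContinuousOn.inv₀ (by fun_prop) fun w hw h => ?_
    rw [sub_eq_zero] at h
    rw [h, mem_sphere_zero_iff_norm] at hw
    rw [mem_ball_zero_iff] at hy
    exact hy.ne hw
  have hne : ∀ {w y : ℂ}, w ∈ sphere (0 : ℂ) r → y ∈ ball (0 : ℂ) r → w - y ≠ 0 := by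
    intro w y hw hy h
    rw [sub_eq_zero] at h
    rw [h, mem_sphere_zero_iff_norm] at hw
    rw [mem_ball_zero_iff] at hy
    exact hy.ne hw
  have hcongr : (∮ w in C(0, r), (joukowski α δ c w - z)⁻¹ * (α - δ / w ^ 2))
      = ∮ w in C(0, r), (((w - u)⁻¹ + (w - v)⁻¹) - (w - 0)⁻¹) := by
    refine circleIntegral.integral_congr hr.le fun w hw => ?_
    have hw0 : w ≠ 0 := sphere_zero_ne_zero hr hw
    have n1 := hne hw hu
    have n2 := hne hw hv
    have e1 : joukowski α δ c w - z = α * (w - u) * (w - v) / w := by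
      rw [joukowski, ← huv]
      field_simp
      ring
    have e2 : (δ : ℂ) = α * u * v := by
      have := huv 0
      linear_combination this
    simp only [e1, e2, sub_zero]
    field_simp
    ring
  have hsum : CircleIntegrable (fun w => (w - u)⁻¹ + (w - v)⁻¹) 0 r := (hint hu).add (hint hv)
  rw [ellipseIntegral, hcongr, circleIntegral.integral_sub hsum (hint h0),
    circleIntegral.integral_add (hint hu) (hint hv),
    circleIntegral.integral_sub_inv_of_mem_ball hu,
    circleIntegral.integral_sub_inv_of_mem_ball hv,
    circleIntegral.integral_sub_inv_of_mem_ball h0, add_sub_cancel_right]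
  exact inv_mul_cancel₀ two_pi_I_ne_zero

end Ellipse

section Matrix

variable {n : ℕ} {A : Matrix (Fin n) (Fin n) ℂ} {α δ r : ℝ} {c : ℂ}

theorem Contour.mem_diff {Ω : Set ℂ} (Γ : Contour Ω A) (i : Fin Γ.num) (t : unitInterval) :
    Γ.curve i t ∈ Ω \ spectrum ℂ A :=
  ⟨Γ.mem i t, Γ.avoids i t⟩

/-- Both cycles wind exactly once around every eigenvalue, so their difference winds around none. -/
theorem isNullCycle_sub (Γ : Contour slitPlane A) (hr : 0 < r) (hα : α ≠ 0)
    (hU : ∀ w ∈ sphere (0 : ℂ) r, joukowski α δ c w ∈ slitPlane \ spectrum ℂ A)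
    (hσ : ∀ z ∈ spectrum ℂ A, ∀ w : ℂ, w ≠ 0 → joukowski α δ c w = z → ‖w‖ < r) :
    IsNullCycle slitPlane (spectrum ℂ A)
      (fun g => Γ.integral g - ellipseIntegral α δ c r g) where
  congr {g h} hgh := by
    have h1 : Γ.integral g = Γ.integral h := by
      rw [Contour.integral, Contour.integral]
      congr 1
      exact Finset.sum_congr rfl fun i _ =>
        lineIntegral_congr (Γ.mem_diff i) hgh
    rw [h1, ellipseIntegral_congr hr hU hgh]
  add {g h} hg hh := by
    have h1 : Γ.integral (fun z => g z + h z) = Γ.integral g + Γ.integral h := by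
      rw [Contour.integral, Contour.integral, Contour.integral, ← mul_add,
        ← Finset.sum_add_distrib]
      congr 1
      exact Finset.sum_congr rfl fun i _ =>
        lineIntegral_add (Γ.piecewiseC1 i) (Γ.mem_diff i) hg hh
    rw [h1, ellipseIntegral_add hr hU hg hh]
    ring
  smul s {g} hg := by
    have h1 : Γ.integral (fun z => s * g z) = s * Γ.integral g := by
      simp only [Contour.integral, lineIntegral_const_mul, ← Finset.mul_sum]
      ring
    rw [h1, ellipseIntegral_const_mul]
    ring
  exact {g F} hg hF := by
    have h1 : Γ.integral g = 0 := by
      rw [Contour.integral, Finset.sum_eq_zero, mul_zero]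
      intro i _
      rw [lineIntegral_eq_sub (Γ.piecewiseC1 i) (Γ.mem_diff i) hg hF,
        sub_self]
    rw [h1, ellipseIntegral_eq_zero hr hU hF, sub_zero]
  inv_sub w hw := by
    have h1 : Γ.integral (fun z => (z - w)⁻¹) = 1 := Γ.winding_eigenvalue w hw
    rw [h1, ellipseIntegral_inv_sub hr hα (hσ w hw), sub_self]

theorem det_map_eval (M : Matrix (Fin n) (Fin n) (Polynomial ℂ)) (z : ℂ) :
    (M.map (Polynomial.eval z)).det = M.det.eval z :=
  ((Polynomial.evalRingHom z).map_det M).symm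

theorem inv_map_eval_apply (M : Matrix (Fin n) (Fin n) (Polynomial ℂ)) (z : ℂ) (k l : Fin n) :
    ((M.map (Polynomial.eval z))⁻¹) k l = (M.adjugate k l).eval z * (M.det.eval z)⁻¹ := by
  have hadj : (M.map (Polynomial.eval z)).adjugate k l = (M.adjugate k l).eval z :=
    congrFun (congrFun ((Polynomial.evalRingHom z).map_adjugate M).symm k) l
  rw [Matrix.inv_def, Matrix.smul_apply, hadj, det_map_eval, Ring.inverse_eq_inv', smul_eq_mul,
    mul_comm]

/-- Cramer's rule for zI - A, with the characteristic polynomial split into linear factors. This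
gives the form that `IsNullCycle.div_prod` needs. -/
theorem exists_resolvent_eq_div (A : Matrix (Fin n) (Fin n) ℂ) (k l : Fin n) :
    ∃ p : Polynomial ℂ, ∀ z, ((z • (1 : Matrix (Fin n) (Fin n) ℂ) - A)⁻¹) k l
      = p.eval z * ((A.charpoly.roots.map fun s => z - s).prod)⁻¹ := by
  refine ⟨A.charmatrix.adjugate k l, fun z => ?_⟩
  have hM : z • (1 : Matrix (Fin n) (Fin n) ℂ) - A = A.charmatrix.map (Polynomial.eval z) := by
    ext i j
    by_cases hij : i = j <;> simp [hij]
  have hdet : A.charmatrix.det.eval z = (A.charpoly.roots.map fun s => z - s).prod := by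
    have h := (IsAlgClosed.splits A.charpoly).eq_prod_roots_of_monic A.charpoly_monic
    change A.charpoly.eval z = _
    conv_lhs => rw [h]
    rw [Polynomial.eval_multiset_prod, Multiset.map_map]
    simp
  rw [hM, inv_map_eval_apply, hdet]

theorem matrixFunction_apply_eq_ellipseIntegral (Γ : Contour slitPlane A) (hr : 0 < r)
    (hα : α ≠ 0) (hA : spectrum ℂ A ⊆ slitPlane)
    (hU : ∀ w ∈ sphere (0 : ℂ) r, joukowski α δ c w ∈ slitPlane \ spectrum ℂ A)
    (hσ : ∀ z ∈ spectrum ℂ A, ∀ w : ℂ, w ≠ 0 → joukowski α δ c w = z → ‖w‖ < r)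
    {f : ℂ → ℂ} (hf : DifferentiableOn ℂ f slitPlane) (k l : Fin n) :
    matrixFunction f A Γ k l = ellipseIntegral α δ c r
      (fun z => f z * ((z • (1 : Matrix (Fin n) (Fin n) ℂ) - A)⁻¹) k l) := by
  obtain ⟨p, hp⟩ := exists_resolvent_eq_div A k l
  have hS : ∀ s ∈ A.charpoly.roots, s ∈ spectrum ℂ A := fun s hs => by
    rw [Matrix.mem_spectrum_iff_isRoot_charpoly]
    exact (Polynomial.mem_roots'.1 hs).2
  have h := (isNullCycle_sub Γ hr hα hU hσ).div_prod hA
    (hf.fun_mul p.differentiable.differentiableOn) A.charpoly.roots hS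
  rw [sub_eq_zero] at h
  have e : (fun z => f z * p.eval z * ((A.charpoly.roots.map fun s => z - s).prod)⁻¹)
      = fun z => f z * ((z • (1 : Matrix (Fin n) (Fin n) ℂ) - A)⁻¹) k l := by
    ext z
    rw [hp]; ring
  rw [e] at h
  rw [← h]
  rfl

end Matrix

end

/-! ### A Carathéodory estimate for off-diagonal entries -/

section

open Complex Metric Set MeasureTheory Real ComplexConjugate

theorem norm_circleAverage_le {F : ℂ → ℂ} {b : ℂ → ℝ} {c : ℂ} {r : ℝ} (hr : 0 ≤ r)
    (hb : CircleIntegrable b c r) (h : ∀ z ∈ sphere c r, ‖F z‖ ≤ b z) :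
    ‖circleAverage F c r‖ ≤ circleAverage b c r := by
  rw [circleAverage_def, circleAverage_def, norm_smul, smul_eq_mul, Real.norm_eq_abs,
    abs_of_pos (by positivity)]
  refine mul_le_mul_of_nonneg_left ?_ (by positivity)
  refine intervalIntegral.norm_integral_le_of_norm_le two_pi_pos.le ?_ hb
  exact Filter.Eventually.of_forall fun t _ => h _ (circleMap_mem_sphere c hr t)

theorem circleAverage_of_differentiableOn_ball {f : ℂ → ℂ} {r R : ℝ} (hr : 0 < r) (hrR : r < R)
    (hf : DifferentiableOn ℂ f (ball 0 R)) : circleAverage f 0 r = f 0 := by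
  refine DiffContOnCl.circleAverage (DifferentiableOn.diffContOnCl (hf.mono ?_))
  rw [abs_of_pos hr]
  exact closure_ball_subset_closedBall.trans (closedBall_subset_ball hrR)

/-- An off-diagonal version of Carathéodory's estimate for functions with positive real part: the
functions `p`, `q` are the diagonal entries and `f`, `g` the off-diagonal entries of a holomorphic
`2 × 2` matrix function on the unit disc with positive Hermitian part. -/
theorem norm_sub_le_of_norm_add_conj_le_of_lt {f g h p q : ℂ → ℂ} {f₀ : ℂ} {m : ℕ} (hm : m ≠ 0)
    (hg : DifferentiableOn ℂ g (ball 0 1)) (hh : DifferentiableOn ℂ h (ball 0 1))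
    (hp : DifferentiableOn ℂ p (ball 0 1)) (hq : DifferentiableOn ℂ q (ball 0 1))
    (hfh : ∀ x ∈ ball (0 : ℂ) 1, f x = f₀ + x ^ m * h x) (hp0 : p 0 = 1) (hq0 : q 0 = 1)
    (hle : ∀ x ∈ ball (0 : ℂ) 1, ‖f x + conj (g x)‖ ≤ (p x).re + (q x).re) {x : ℂ} {r : ℝ}
    (hxr : ‖x‖ < r) (hr1 : r < 1) :
    ‖f x - f₀‖ ≤ 2 * ((‖x‖ / r) ^ m / (1 - ‖x‖ / r)) := by
  have hr : 0 < r := (norm_nonneg x).trans_lt hxr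
  have hs1 : ‖x‖ / r < 1 := (div_lt_one hr).2 hxr
  have hsub : sphere (0 : ℂ) r ⊆ ball 0 1 := fun z hz => by
    rw [mem_sphere_zero_iff_norm] at hz
    rw [mem_ball_zero_iff, hz]; exact hr1
  have hz0 : ∀ z ∈ sphere (0 : ℂ) r, z ≠ 0 := by
    rintro z hz rfl
    simp at hz
    exact hr.ne hz
  have hzx : ∀ z ∈ sphere (0 : ℂ) r, z - x ≠ 0 := by
    intro z hz h
    rw [sub_eq_zero] at h
    rw [mem_sphere_zero_iff_norm, h] at hz
    exact hxr.ne hz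
  -- K is the Cauchy kernel z/(z - x) times (x/z)^m. The extra factor divides out the zero of f -
  -- f₀, so averaging against K still reproduces f(x) - f₀.
  set K : ℂ → ℂ := fun z => (x / z) ^ m * (z / (z - x)) with hK
  have hKc : ContinuousOn K (sphere 0 r) := by
    refine ContinuousOn.mul (ContinuousOn.pow ?_ m) ?_
    · exact continuousOn_const.div continuousOn_id hz0
    · exact continuousOn_id.div (by fun_prop) hzx
  have hfc : ContinuousOn f (ball 0 1) := by
    refine ContinuousOn.congr (f := fun x => f₀ + x ^ m * h x) ?_ hfh
    exact continuousOn_const.add ((by fun_prop : Continuous fun x : ℂ => x ^ m).continuousOn.mul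
      hh.continuousOn)
  have hx1 : x ∈ ball (0 : ℂ) 1 := by rw [mem_ball_zero_iff]; exact hxr.trans hr1
  have e1 : circleAverage (fun z => (f z - f₀) * K z) 0 r = f x - f₀ := by
    have hd : DiffContOnCl ℂ (fun z => x ^ m * h z) (ball 0 |r|) := by
      refine DifferentiableOn.diffContOnCl ((hh.const_mul _).mono ?_)
      rw [abs_of_pos hr]
      exact closure_ball_subset_closedBall.trans (closedBall_subset_ball hr1)
    have := hd.circleAverage_smul_div (w := x)
      (by rw [abs_of_pos hr, mem_ball_zero_iff]; exact hxr)
    rw [hfh x hx1, add_sub_cancel_left, ← this]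
    refine circleAverage_congr_sphere fun z hz => ?_
    rw [abs_of_pos hr] at hz
    have h0 := hz0 z hz
    have h1 := hzx z hz
    simp only [hK, hfh z (hsub hz), smul_eq_mul, sub_zero, div_pow]
    field_simp
    ring
  -- On |z| = r one has x/z = x z̄/r². The integrand is therefore the conjugate of a holomorphic
  -- function G that vanishes at 0 because m ≠ 0, and its mean is 0.
  have e2 : circleAverage (fun z => (conj (g z) + f₀) * K z) 0 r = 0 := by
    set G : ℂ → ℂ := fun z => (g z + conj f₀) *
      ((conj x * z / r ^ 2) ^ m * (1 - conj x * z / r ^ 2)⁻¹) with hG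
    -- The pole of G lies at modulus r²/|x|. Replacing |x| by the midpoint (|x| + r)/2 gives a
    -- radius greater than r and free of the pole, also when x = 0.
    set R : ℝ := min 1 (r ^ 2 / (‖x‖ + (r - ‖x‖) / 2)) with hR
    have hpos : 0 < ‖x‖ + (r - ‖x‖) / 2 := by linarith [norm_nonneg x]
    have hrR : r < R := by
      refine lt_min hr1 ?_
      rw [lt_div_iff₀ hpos]
      nlinarith
    have hGd : DifferentiableOn ℂ G (ball 0 R) := by
      refine DifferentiableOn.mul ((hg.mono (ball_subset_ball (min_le_left _ _))).add_const _) ?_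
      refine DifferentiableOn.mul (by fun_prop) (DifferentiableOn.inv (by fun_prop) ?_)
      intro z hz h
      rw [sub_eq_zero] at h
      have hn := congrArg norm h
      rw [norm_div, norm_mul, norm_pow, RCLike.norm_conj, norm_real, norm_one,
        Real.norm_eq_abs, abs_of_pos hr, eq_div_iff (by positivity), one_mul] at hn
      rw [mem_ball_zero_iff] at hz
      have h1 : ‖z‖ < r ^ 2 / (‖x‖ + (r - ‖x‖) / 2) := hz.trans_le (min_le_right _ _)
      rw [lt_div_iff₀ hpos] at h1
      nlinarith [norm_nonneg z]
    have hG0 := circleAverage_of_differentiableOn_ball hr hrR hGd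
    have hG00 : G 0 = 0 := by simp [hG, hm]
    rw [hG00] at hG0
    have hci : CircleIntegrable G 0 r := by
      refine (hGd.continuousOn.mono ?_).circleIntegrable hr.le
      exact sphere_subset_closedBall.trans (closedBall_subset_ball hrR)
    have hcomm := ContinuousLinearMap.circleAverage_comp_comm (conjCLE : ℂ →L[ℝ] ℂ) hci
    rw [hG0, map_zero] at hcomm
    refine Eq.trans ?_ hcomm
    refine circleAverage_congr_sphere fun z hz => ?_
    rw [abs_of_pos hr] at hz
    have h0 := hz0 z hz
    have h1 := hzx z hz
    have hzz : z * conj z = (r : ℂ) ^ 2 := by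
      rw [mul_conj, normSq_eq_norm_sq, mem_sphere_zero_iff_norm.1 hz]
      push_cast; rfl
    have hcz : conj z ≠ 0 := by simpa using h0
    have hq : x * conj z / (r : ℂ) ^ 2 = x / z := by
      rw [← hzz]; field_simp
    have hc : conj (G z) = (conj (g z) + f₀) *
        ((x * conj z / (r : ℂ) ^ 2) ^ m * (1 - x * conj z / (r : ℂ) ^ 2)⁻¹) := by
      simp [hG]
    simp only [Function.comp, ContinuousLinearEquiv.coe_coe, conjCLE_apply]
    rw [hc, hq, hK]
    have : (1 - x / z)⁻¹ = z / (z - x) := by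
      rw [one_sub_div h0, inv_div]
    rw [this]
  have hgc : ContinuousOn (fun z => conj (g z)) (sphere 0 r) :=
    continuous_conj.comp_continuousOn (hg.continuousOn.mono hsub)
  have i1 : CircleIntegrable (fun z => (f z - f₀) * K z) 0 r :=
    (((hfc.mono hsub).sub continuousOn_const).mul hKc).circleIntegrable hr.le
  have i2 : CircleIntegrable (fun z => (conj (g z) + f₀) * K z) 0 r :=
    ((hgc.add continuousOn_const).mul hKc).circleIntegrable hr.le
  have e3 : circleAverage (fun z => (f z + conj (g z)) * K z) 0 r = f x - f₀ := by
    have := circleAverage_fun_add i1 i2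
    rw [e1, e2, add_zero] at this
    rw [← this]
    congr 1; ext z; ring
  have hpi : CircleIntegrable (fun z => p z + q z) 0 r :=
    ((hp.continuousOn.mono hsub).add (hq.continuousOn.mono hsub)).circleIntegrable hr.le
  -- By the mean value property the majorant averages to Re p(0) + Re q(0) = 2, the source of the
  -- factor 2 in the bound.
  have e4 : circleAverage (fun z => (p z).re + (q z).re) 0 r = 2 := by
    have h1 := ContinuousLinearMap.circleAverage_comp_comm reCLM hpi
    have h2 := circleAverage_of_differentiableOn_ball hr hr1 (hp.fun_add hq)
    rw [h2, hp0, hq0] at h1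
    norm_num at h1
    rw [← h1]
    congr 1
  set C : ℝ := (‖x‖ / r) ^ m / (1 - ‖x‖ / r) with hC
  have hbi : CircleIntegrable (fun z => C • ((p z).re + (q z).re)) 0 r := by
    refine ContinuousOn.circleIntegrable hr.le (ContinuousOn.fun_const_smul (ContinuousOn.fun_add ?_ ?_) C)
    · exact continuous_re.comp_continuousOn (hp.continuousOn.mono hsub)
    · exact continuous_re.comp_continuousOn (hq.continuousOn.mono hsub)
  rw [← e3]
  refine (norm_circleAverage_le hr.le hbi fun z hz => ?_).trans_eq ?_
  · rw [norm_mul, smul_eq_mul, mul_comm C]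
    refine mul_le_mul (hle z (hsub hz)) ?_ (norm_nonneg _)
      ((norm_nonneg _).trans (hle z (hsub hz)))
    have hzr : ‖z‖ = r := mem_sphere_zero_iff_norm.1 hz
    simp only [hK, hC]
    rw [norm_mul, norm_pow, norm_div, norm_div, hzr, div_eq_mul_inv (_ ^ m)]
    refine mul_le_mul_of_nonneg_left ?_ (by positivity)
    rw [one_sub_div hr.ne', inv_div]
    refine div_le_div_of_nonneg_left hr.le (by linarith) ?_
    have := norm_sub_norm_le z x
    rwa [hzr] at this
  · rw [circleAverage_fun_smul, e4, smul_eq_mul, mul_comm]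

/-- The radius r of the previous estimate tends to 1. -/
theorem norm_le_of_norm_add_conj_le {f g h p q : ℂ → ℂ} {m : ℕ}
    (hf0 : ‖f 0‖ ≤ 1)
    (hg : DifferentiableOn ℂ g (ball 0 1)) (hh : DifferentiableOn ℂ h (ball 0 1))
    (hp : DifferentiableOn ℂ p (ball 0 1)) (hq : DifferentiableOn ℂ q (ball 0 1))
    (hfh : ∀ x ∈ ball (0 : ℂ) 1, f x = x ^ m * h x) (hp0 : p 0 = 1) (hq0 : q 0 = 1)
    (hle : ∀ x ∈ ball (0 : ℂ) 1, ‖f x + conj (g x)‖ ≤ (p x).re + (q x).re) {x : ℂ}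
    (hx : ‖x‖ < 1) :
    ‖f x‖ ≤ 2 * (‖x‖ ^ m / (1 - ‖x‖)) := by
  have key : ∀ r : ℝ, ‖x‖ < r → r < 1 → ‖f x‖ ≤ 2 * ((‖x‖ / r) ^ m / (1 - ‖x‖ / r)) := by
    intro r hxr hr1
    have hr : 0 < r := (norm_nonneg x).trans_lt hxr
    -- For m = 0 the estimate is applied to f - f(0) with exponent 1. With s = |x|/r, the bound
    -- 2s/(1-s) + |f(0)| ≤ 2s/(1-s) + 2 = 2/(1-s) is of the required form.
    rcases Nat.eq_zero_or_pos m with rfl | hm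
    · have hf : DifferentiableOn ℂ f (ball 0 1) := hh.congr fun x hx => by simp [hfh x hx]
      have hd : DifferentiableOn ℂ (dslope f 0) (ball 0 1) :=
        (differentiableOn_dslope (ball_mem_nhds 0 one_pos)).2 hf
      have h1 := norm_sub_le_of_norm_add_conj_le_of_lt (f₀ := f 0) one_ne_zero hg hd hp hq
        (fun y _ => by
          have := sub_smul_dslope f 0 y
          simp only [sub_zero, smul_eq_mul] at this
          rw [pow_one, this]; ring) hp0 hq0 hle hxr hr1
      have hs1 : 0 < 1 - ‖x‖ / r := sub_pos.2 ((div_lt_one hr).2 hxr)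
      have h2 : ‖f x‖ ≤ ‖f x - f 0‖ + ‖f 0‖ := by
        simpa using norm_add_le (f x - f 0) (f 0)
      have h3 : (‖x‖ / r) ^ 1 / (1 - ‖x‖ / r) + 1 = (‖x‖ / r) ^ 0 / (1 - ‖x‖ / r) := by
        rw [pow_one, pow_zero, div_add_one hs1.ne']; congr 1; ring
      linarith
    · have h1 := norm_sub_le_of_norm_add_conj_le_of_lt (f₀ := 0) hm.ne' hg hh hp hq
        (fun y hy => by rw [hfh y hy, zero_add]) hp0 hq0 hle hxr hr1
      simpa using h1
  have hcont : ContinuousAt (fun r : ℝ => 2 * ((‖x‖ / r) ^ m / (1 - ‖x‖ / r))) 1 := by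
    refine ContinuousAt.mul continuousAt_const (ContinuousAt.div ?_ ?_ ?_)
    · exact (continuousAt_const.div continuousAt_id one_ne_zero).pow m
    · exact continuousAt_const.sub (continuousAt_const.div continuousAt_id one_ne_zero)
    · simpa using (sub_pos.2 hx).ne'
  have hlim := hcont.tendsto.mono_left (nhdsWithin_le_nhds (s := Iio 1))
  simp only [div_one] at hlim
  refine ge_of_tendsto hlim ?_
  filter_upwards [Ioo_mem_nhdsLT hx] with r hr
  exact key r hr.1 hr.2

end

/-! ### From the field of values to a resolvent bound -/

section

open Complex Metric Set Matrix ComplexConjugate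

section Inverse

variable {n : ℕ}

/-- The quadratic form is tested on e_k + ζ e_l, with a unimodular ζ that turns M_{kl} + conj M_{lk}
to the negative real axis. -/
theorem norm_add_conj_le_of_re_nonneg {M : Matrix (Fin n) (Fin n) ℂ}
    (hM : ∀ v : Fin n → ℂ, 0 ≤ (star v ⬝ᵥ (M *ᵥ v)).re) (k l : Fin n) :
    ‖M k l + conj (M l k)‖ ≤ (M k k).re + (M l l).re := by
  have hexp : ∀ ζ : ℂ, star (Pi.single k 1 + ζ • Pi.single l 1 : Fin n → ℂ) ⬝ᵥ
      (M *ᵥ (Pi.single k 1 + ζ • Pi.single l 1))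
      = M k k + ζ * M k l + conj ζ * (M l k + ζ * M l l) := by
    intro ζ
    have hs : ∀ i : Fin n, star (Pi.single i 1 : Fin n → ℂ) = Pi.single i 1 := by
      intro i
      rw [← Pi.single_star, star_one]
    rw [star_add, star_smul, hs, hs, mulVec_add, mulVec_smul, add_dotProduct, smul_dotProduct,
      dotProduct_add, dotProduct_add, dotProduct_smul, dotProduct_smul]
    simp
  set Z := M k l + conj (M l k) with hZ
  obtain ⟨ζ, h1, h2⟩ : ∃ ζ : ℂ, ζ * conj ζ = 1 ∧ ζ * Z = -(‖Z‖ : ℂ) := by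
    by_cases h0 : Z = 0
    · exact ⟨1, by simp, by simp [h0]⟩
    · have hn : (‖Z‖ : ℂ) ≠ 0 := by simpa using h0
      have hm : Z * conj Z = (‖Z‖ : ℂ) ^ 2 := by
        rw [mul_conj, normSq_eq_norm_sq]; push_cast; rfl
      refine ⟨-(conj Z / ‖Z‖), ?_, ?_⟩
      · simp only [map_neg, map_div₀, conj_conj, conj_ofReal]
        field_simp
        linear_combination hm
      · field_simp
        linear_combination -hm
  have h3 := hM (Pi.single k 1 + ζ • Pi.single l 1)
  rw [hexp] at h3
  have h4 : (M k k + ζ * M k l + conj ζ * (M l k + ζ * M l l)).re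
      = (M k k).re + (M l l).re + (ζ * Z).re := by
    have e : M k k + ζ * M k l + conj ζ * (M l k + ζ * M l l)
        = M k k + (ζ * conj ζ) * M l l + (ζ * M k l + conj ζ * M l k) := by ring
    rw [e, h1, one_mul, hZ, mul_add]
    simp only [add_re, mul_re, conj_re, conj_im]
    ring
  rw [h4, h2] at h3
  simp only [neg_re, ofReal_re] at h3
  linarith

end Inverse

/-! ### Supporting half-planes of the ellipse -/

section Support

/-- The left side is a combination of p and q with weights of total at most s; the margin e > 0
makes the inequality strict. It serves `re_support_pos`. -/
theorem support_bound {s a₁ a₂ p q e u v : ℝ} (hs : 0 < s) (h₁ : 0 < a₁) (h₁₂ : a₁ ≤ a₂)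
    (he : 0 < e) (hu : 0 ≤ u) (hv : 0 ≤ v) (huv : u + v ≤ s) (hp : s * p ≤ a₂ - e)
    (hq : s * q ≤ a₁ - e) : a₁ * (u * p) + a₂ * (v * q) < a₁ * a₂ := by
  have h₂ : 0 < a₂ := h₁.trans_le h₁₂
  rcases (add_nonneg hu hv).eq_or_lt with h0 | hpos
  · have hu' : u = 0 := by linarith
    have hv' : v = 0 := by linarith
    simpa [hu', hv'] using mul_pos h₁ h₂
  · have c1 := mul_le_mul_of_nonneg_left hp (mul_nonneg h₁.le hu)
    have c2 := mul_le_mul_of_nonneg_left hq (mul_nonneg h₂.le hv)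
    have d1 : 0 ≤ a₁ * a₂ * (s - (u + v)) :=
      mul_nonneg (mul_nonneg h₁.le h₂.le) (by linarith)
    have d2 : 0 < e * (a₁ * u + a₂ * v) := by
      refine mul_pos he ?_
      have := mul_pos h₁ hpos
      have := mul_le_mul_of_nonneg_right h₁₂ hv
      linarith
    refine lt_of_mul_lt_mul_left ?_ hs.le
    linarith

/-- The supporting half-planes of the ellipse with semi-axes `α + δ`, `α - δ`, in terms of the
inverse `x` of the Joukowski parameter. -/
theorem re_support_pos {α δ : ℝ} (hδ : 0 ≤ δ) (hδα : δ < α) {ζ x : ℂ}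
    (hζ : (ζ.re / (α + δ)) ^ 2 + (ζ.im / (α - δ)) ^ 2 ≤ 1) (hx : ‖x‖ < 1) :
    0 < (conj (α - δ * x ^ 2) * (α + δ * x ^ 2 - x * ζ)).re := by
  set s := ‖x‖ with hs
  have hs0 : 0 ≤ s := norm_nonneg x
  have hsq : s ^ 2 = x.re ^ 2 + x.im ^ 2 := by
    rw [hs, ← normSq_eq_norm_sq, normSq_apply]; ring
  -- In these coordinates the ellipse becomes the unit disc P² + Q² ≤ 1.
  set P := ζ.re / (α + δ) with hP
  set Q := ζ.im / (α - δ) with hQ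
  have e1 : ζ.re = P * (α + δ) := by rw [hP, div_mul_cancel₀]; linarith
  have e2 : ζ.im = Q * (α - δ) := by rw [hQ, div_mul_cancel₀]; linarith
  have hre : (conj (α - δ * x ^ 2) * (α + δ * x ^ 2 - x * ζ)).re
      = (α - δ * s ^ 2) * (α + δ * s ^ 2)
        - ((α - δ * s ^ 2) * (x.re * P * (α + δ)) - (α + δ * s ^ 2) * (x.im * Q * (α - δ))) := by
    rw [hsq]
    simp only [map_sub, map_mul, conj_ofReal, mul_re, mul_im, sub_re, sub_im, add_re,
      add_im, ofReal_re, ofReal_im, pow_two, conj_re, conj_im, e1, e2]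
    ring
  rw [hre]
  have hs2 : s ^ 2 ≤ 1 := by nlinarith
  have hM1 : 0 < α - δ * s ^ 2 := by nlinarith
  have hM2 : α - δ * s ^ 2 ≤ α + δ * s ^ 2 := by nlinarith [sq_nonneg s]
  rcases hs0.eq_or_lt with h0 | hspos
  · have hx0 : x = 0 := norm_eq_zero.1 h0.symm
    simp only [hx0, zero_re, zero_im, zero_mul, mul_zero, sub_zero]
    exact mul_pos hM1 (hM1.trans_le hM2)
  set u := |x.re * P| with hu
  set v := |x.im * Q| with hv
  -- Cauchy–Schwarz for (|Re x|, |Im x|) and (|P|, |Q|).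
  have huv : u + v ≤ s := by
    refine abs_le_of_sq_le_sq' ?_ hs0 |>.2
    rw [hsq]
    have h1 : u ^ 2 = (x.re * P) ^ 2 := sq_abs _
    have h2 : v ^ 2 = (x.im * Q) ^ 2 := sq_abs _
    have h3 : u * v = |x.re * Q| * |x.im * P| := by
      rw [hu, hv]; simp only [abs_mul]; ring
    have h4 : 2 * (|x.re * Q| * |x.im * P|) ≤ (x.re * Q) ^ 2 + (x.im * P) ^ 2 := by
      have := two_mul_le_add_sq |x.re * Q| |x.im * P|
      rw [sq_abs, sq_abs] at this
      linarith
    have h5 : (x.re ^ 2 + x.im ^ 2) * (P ^ 2 + Q ^ 2) ≤ (x.re ^ 2 + x.im ^ 2) * 1 :=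
      mul_le_mul_of_nonneg_left hζ (by positivity)
    nlinarith
  have hu0 : 0 ≤ u := abs_nonneg _
  have hv0 : 0 ≤ v := abs_nonneg _
  have hxu : x.re * P ≤ u := le_abs_self _
  have hxv : -(x.im * Q) ≤ v := neg_le_abs _
  -- This margin serves both bounds below: the remaining slack is δ(1-s)² in the first and
  -- δ(1-s)(1+s) in the second.
  set e := (1 - s) * (α - δ) with he
  have hepos : 0 < e := mul_pos (by linarith) (by linarith)
  have g1 : s * (α + δ) ≤ α + δ * s ^ 2 - e := by
    have : 0 ≤ (1 - s) * (δ * (1 - s)) := by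
      have : 0 ≤ 1 - s := by linarith
      positivity
    rw [he]; nlinarith
  have g2 : s * (α - δ) ≤ α - δ * s ^ 2 - e := by
    have : 0 ≤ (1 - s) * (δ * (1 + s)) := by
      have : 0 ≤ 1 - s := by linarith
      positivity
    rw [he]; nlinarith
  have b1 : (α - δ * s ^ 2) * (x.re * P * (α + δ)) ≤ (α - δ * s ^ 2) * (u * (α + δ)) :=
    mul_le_mul_of_nonneg_left (mul_le_mul_of_nonneg_right hxu (by linarith)) hM1.le
  have b2 : (α + δ * s ^ 2) * (-(x.im * Q) * (α - δ)) ≤ (α + δ * s ^ 2) * (v * (α - δ)) :=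
    mul_le_mul_of_nonneg_left (mul_le_mul_of_nonneg_right hxv (by linarith)) (hM1.le.trans hM2)
  have key := support_bound hspos hM1 hM2 hepos hu0 hv0 huv g1 g2
  linarith

end Support

/-! ### Powers of banded matrices -/

section Band

variable {n : ℕ} {β γ β' γ' : ℕ} {A B : Matrix (Fin n) (Fin n) ℂ}

theorem IsBanded.mul (hA : IsBanded β γ A) (hB : IsBanded β' γ' B) :
    IsBanded (β + β') (γ + γ') (A * B) := by
  intro k l h
  rw [Matrix.mul_apply]
  refine Finset.sum_eq_zero fun j _ => ?_
  by_cases hkj : A k j = 0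
  · rw [hkj, zero_mul]
  by_cases hjl : B j l = 0
  · rw [hjl, mul_zero]
  have h1 := mt (hA k j) hkj
  have h2 := mt (hB j l) hjl
  push_cast at h
  omega

theorem IsBanded.sub_smul_one (hA : IsBanded β γ A) (c : ℂ) : IsBanded β γ (A - c • 1) := by
  intro k l h
  have hkl : k ≠ l := by
    rintro rfl
    omega
  simp [hA k l h, hkl]

theorem IsBanded.pow (hA : IsBanded β γ A) (m : ℕ) : IsBanded (m * β) (m * γ) (A ^ m) := by
  induction m with
  | zero =>
    intro k l h
    have hkl : k ≠ l := by
      rintro rfl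
      omega
    simp [hkl]
  | succ m ih =>
    rw [pow_succ, add_mul, add_mul, one_mul, one_mul]
    exact ih.mul hA

theorem IsBanded.pow_apply_eq_zero (hA : IsBanded β γ A) (hβ : β ≠ 0) (hγ : γ ≠ 0) {k l : Fin n}
    {m : ℕ} (hm : m < bandExponent β γ k l) : (A ^ m) k l = 0 := by
  refine hA.pow m k l ?_
  have hβ' : (0 : ℝ) < β := by exact_mod_cast Nat.pos_of_ne_zero hβ
  have hγ' : (0 : ℝ) < γ := by exact_mod_cast Nat.pos_of_ne_zero hγ
  rw [bandExponent] at hm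
  split_ifs at hm
  · left
    rw [Nat.lt_ceil, lt_div_iff₀ hβ'] at hm
    have : ((((m * β : ℕ) : ℤ)) : ℝ) < (((l : ℤ) - (k : ℤ) : ℤ) : ℝ) := by push_cast; exact hm
    exact_mod_cast this
  · right
    rw [Nat.lt_ceil, lt_div_iff₀ hγ'] at hm
    have : ((((m * γ : ℕ) : ℤ)) : ℝ) < (((k : ℤ) - (l : ℤ) : ℤ) : ℝ) := by push_cast; exact hm
    exact_mod_cast this

end Band

/-! ### The Joukowski pencil and the entries of the resolvent -/

section Pencil

variable {n : ℕ} {A B : Matrix (Fin n) (Fin n) ℂ} {α δ : ℝ} {c x : ℂ}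

/-- The matrix `(α + δ x²) I - x B`. With `x = 1 / w` and `B = A - c I` it is `x` times
`ψ(w) I - A`, where `ψ` is the Joukowski map. -/
noncomputable def joukowskiPencil (α δ : ℝ) (B : Matrix (Fin n) (Fin n) ℂ) (x : ℂ) :
    Matrix (Fin n) (Fin n) ℂ :=
  ((α : ℂ) + δ * x ^ 2) • 1 - x • B

/-- Cramer's rule makes the entries of the inverse rational in x, hence holomorphic wherever the
determinant is nonzero. -/
theorem exists_inv_joukowskiPencil_eq_div (α δ : ℝ) (B : Matrix (Fin n) (Fin n) ℂ) :
    ∃ q : Polynomial ℂ, (∀ x, (joukowskiPencil α δ B x).det = q.eval x) ∧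
      ∀ k l, ∃ p : Polynomial ℂ, ∀ x,
        ((joukowskiPencil α δ B x)⁻¹) k l = p.eval x * (q.eval x)⁻¹ := by
  set M : Matrix (Fin n) (Fin n) (Polynomial ℂ) :=
    Matrix.of fun i j => (Polynomial.C (α : ℂ) + Polynomial.C (δ : ℂ) * Polynomial.X ^ 2) *
      (1 : Matrix (Fin n) (Fin n) (Polynomial ℂ)) i j - Polynomial.X * Polynomial.C (B i j) with hM
  have hMx : ∀ x, joukowskiPencil α δ B x = M.map (Polynomial.eval x) := by
    intro x
    ext i j
    by_cases hij : i = j <;> simp [joukowskiPencil, hM, hij] <;> ring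
  refine ⟨M.det, fun x => ?_, fun k l => ⟨M.adjugate k l, fun x => ?_⟩⟩
  · rw [hMx, det_map_eval]
  · rw [hMx, inv_map_eval_apply]

theorem fieldOfValues_smul_mem {v : Fin n → ℂ} (hv : v ≠ 0) :
    ∃ t : ℝ, 0 < t ∧ star v ⬝ᵥ v = (t : ℂ) ∧
      ∃ ζ ∈ fieldOfValues A, star v ⬝ᵥ (A *ᵥ v) = t * ζ := by
  set V : EuclideanSpace ℂ (Fin n) := WithLp.toLp 2 v with hV
  have hV0 : V ≠ 0 := by
    intro h
    apply hv
    have := congrArg WithLp.ofLp h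
    simpa [hV] using this
  have hn : 0 < ‖V‖ := norm_pos_iff.2 hV0
  have hn' : (‖V‖ : ℂ) ≠ 0 := by exact_mod_cast hn.ne'
  refine ⟨‖V‖ ^ 2, by positivity, ?_, _, ⟨((‖V‖ : ℂ)⁻¹) • V, ?_, rfl⟩, ?_⟩
  · have h := EuclideanSpace.norm_sq_eq V
    rw [h]
    push_cast
    rw [dotProduct]
    refine Finset.sum_congr rfl fun i _ => ?_
    have : (starRingEnd ℂ) (v i) * v i = ((‖v i‖ : ℂ)) ^ 2 := by
      rw [mul_comm, mul_conj, normSq_eq_norm_sq]; push_cast; rfl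
    simpa using this
  · rw [norm_smul, norm_inv, norm_real, norm_norm, inv_mul_cancel₀ hn.ne']
  · have h1 : ((‖V‖ : ℂ)⁻¹ • V).ofLp = (‖V‖ : ℂ)⁻¹ • v := rfl
    rw [h1, mulVec_smul, star_smul, smul_dotProduct, dotProduct_smul]
    simp only [star_inv₀, RCLike.star_def, conj_ofReal, smul_eq_mul]
    push_cast
    field_simp

/-- After normalizing v, the quadratic form of A is a point of W(A), and `re_support_pos` applies to
it. -/
theorem re_joukowskiPencil_pos (hδ : 0 ≤ δ) (hδα : δ < α)
    (hW : ∀ ζ ∈ fieldOfValues A,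
      ((ζ.re - c.re) / (α + δ)) ^ 2 + ((ζ.im - c.im) / (α - δ)) ^ 2 ≤ 1)
    (hx : ‖x‖ < 1) {v : Fin n → ℂ} (hv : v ≠ 0) :
    0 < (conj (α - δ * x ^ 2) *
      (star v ⬝ᵥ (joukowskiPencil α δ (A - c • 1) x *ᵥ v))).re := by
  obtain ⟨t, ht, htv, ζ, hζ, hAv⟩ := fieldOfValues_smul_mem (A := A) hv
  have h := re_support_pos hδ hδα (ζ := ζ - c) (by simpa using hW ζ hζ) hx
  have e : conj (α - δ * x ^ 2) * (star v ⬝ᵥ (joukowskiPencil α δ (A - c • 1) x *ᵥ v))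
      = t * (conj (α - δ * x ^ 2) * (α + δ * x ^ 2 - x * (ζ - c))) := by
    rw [joukowskiPencil, sub_mulVec, smul_mulVec, smul_mulVec, sub_mulVec, smul_mulVec, one_mulVec,
      dotProduct_sub, dotProduct_smul, dotProduct_smul, dotProduct_sub, dotProduct_smul, htv, hAv]
    simp only [smul_eq_mul]
    ring
  rw [e, re_ofReal_mul]
  exact mul_pos ht h

theorem det_joukowskiPencil_ne_zero (hδ : 0 ≤ δ) (hδα : δ < α)
    (hW : ∀ ζ ∈ fieldOfValues A,
      ((ζ.re - c.re) / (α + δ)) ^ 2 + ((ζ.im - c.im) / (α - δ)) ^ 2 ≤ 1)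
    (hx : ‖x‖ < 1) :
    (joukowskiPencil α δ (A - c • 1) x).det ≠ 0 := by
  intro h
  obtain ⟨v, hv, hv0⟩ := Matrix.exists_mulVec_eq_zero_iff.2 h
  have := re_joukowskiPencil_pos hδ hδα hW hx hv
  rw [hv0] at this
  simp at this

theorem add_mul_sq_ne_zero (hδ : 0 ≤ δ) (hδα : δ < α) (hx : ‖x‖ < 1) : (α : ℂ) + δ * x ^ 2 ≠ 0 := by
  intro h
  have h1 : (α : ℂ) = -(δ * x ^ 2) := eq_neg_of_add_eq_zero_left h
  have h2 := congrArg norm h1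
  rw [norm_neg, norm_mul, norm_pow, norm_real, norm_real, Real.norm_eq_abs, Real.norm_eq_abs,
    abs_of_pos (hδ.trans_lt hδα), abs_of_nonneg hδ] at h2
  have h3 : ‖x‖ ^ 2 ≤ 1 := pow_le_one₀ (norm_nonneg x) hx.le
  nlinarith

/-- Positivity passes to the inverse: with u = Nv, the form u*(κN⁻¹)u is the conjugate of κ̄ v*Nv.
-/
theorem re_inv_joukowskiPencil_nonneg (hδ : 0 ≤ δ) (hδα : δ < α)
    (hW : ∀ ζ ∈ fieldOfValues A,
      ((ζ.re - c.re) / (α + δ)) ^ 2 + ((ζ.im - c.im) / (α - δ)) ^ 2 ≤ 1)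
    (hx : ‖x‖ < 1) (u : Fin n → ℂ) :
    0 ≤ (star u ⬝ᵥ ((((α : ℂ) - δ * x ^ 2) •
      (joukowskiPencil α δ (A - c • 1) x)⁻¹) *ᵥ u)).re := by
  set N := joukowskiPencil α δ (A - c • 1) x with hN
  have hdet : IsUnit N.det := (det_joukowskiPencil_ne_zero hδ hδα hW hx).isUnit
  set v := N⁻¹ *ᵥ u with hv
  have hu : u = N *ᵥ v := by
    rw [hv, mulVec_mulVec, Matrix.mul_nonsing_inv _ hdet, one_mulVec]
  rw [smul_mulVec, ← hv, dotProduct_smul, smul_eq_mul]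
  by_cases hv0 : v = 0
  · simp [hv0]
  have h := re_joukowskiPencil_pos hδ hδα hW hx hv0
  rw [← hN, ← hu] at h
  have e : star u ⬝ᵥ v = conj (star v ⬝ᵥ u) := by
    rw [starRingEnd_apply, star_dotProduct]
  rw [e]
  rw [← conj_re] at h
  rw [map_mul, conj_conj] at h
  exact h.le

/-- A finite Neumann expansion with exact remainder. When the (k,l) entries of the lower powers of B
vanish, only the remainder, with its factor x^m, survives. -/
theorem inv_joukowskiPencil_eq_sum {B : Matrix (Fin n) (Fin n) ℂ}
    (hg : (α : ℂ) + δ * x ^ 2 ≠ 0) (hdet : (joukowskiPencil α δ B x).det ≠ 0) (m : ℕ) :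
    (joukowskiPencil α δ B x)⁻¹
      = ∑ i ∈ Finset.range m, (x ^ i * ((α + δ * x ^ 2) ^ (i + 1))⁻¹) • B ^ i
        + (x ^ m * ((α + δ * x ^ 2) ^ m)⁻¹) • (B ^ m * (joukowskiPencil α δ B x)⁻¹) := by
  set g : ℂ := α + δ * x ^ 2 with hgdef
  set N := joukowskiPencil α δ B x with hN
  have h1 : g • N⁻¹ = 1 + x • (B * N⁻¹) := by
    have h2 : N * N⁻¹ = 1 := Matrix.mul_nonsing_inv _ hdet.isUnit
    have h3 : g • (1 : Matrix (Fin n) (Fin n) ℂ) = N + x • B := (sub_add_cancel _ _).symm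
    calc g • N⁻¹ = (g • 1) * N⁻¹ := by rw [smul_mul_assoc, one_mul]
      _ = 1 + x • (B * N⁻¹) := by rw [h3, add_mul, h2, smul_mul_assoc]
  have h3 : N⁻¹ = g⁻¹ • (1 + x • (B * N⁻¹)) := by
    rw [← h1, smul_smul, inv_mul_cancel₀ hg, one_smul]
  induction m with
  | zero => simp
  | succ m ih =>
    have h4 : B ^ m * N⁻¹ = g⁻¹ • B ^ m + (g⁻¹ * x) • (B ^ (m + 1) * N⁻¹) := by
      conv_lhs => rw [h3]
      rw [mul_smul_comm, mul_add, mul_one, mul_smul_comm, ← mul_assoc, ← pow_succ, smul_add,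
        smul_smul]
    rw [Finset.sum_range_succ, add_assoc]
    conv_lhs => rw [ih]
    rw [h4, smul_add, smul_smul, smul_smul]
    congr 3
    · rw [pow_succ g, mul_inv, mul_assoc]
    · rw [pow_succ g, mul_inv, pow_succ x]; ring

theorem norm_inv_joukowskiPencil_le (hδ : 0 ≤ δ) (hδα : δ < α)
    (hW : ∀ ζ ∈ fieldOfValues A,
      ((ζ.re - c.re) / (α + δ)) ^ 2 + ((ζ.im - c.im) / (α - δ)) ^ 2 ≤ 1)
    {k l : Fin n} {m : ℕ} (hm : ∀ i < m, ((A - c • 1) ^ i) k l = 0) (hx : ‖x‖ < 1) :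
    ‖(α - δ * x ^ 2) * ((joukowskiPencil α δ (A - c • 1) x)⁻¹) k l‖
      ≤ 2 * (‖x‖ ^ m / (1 - ‖x‖)) := by
  have hα : (α : ℂ) ≠ 0 := by exact_mod_cast (hδ.trans_lt hδα).ne'
  set N : ℂ → Matrix (Fin n) (Fin n) ℂ := joukowskiPencil α δ (A - c • 1) with hN
  have hball : ∀ {y : ℂ}, y ∈ ball (0 : ℂ) 1 → ‖y‖ < 1 := mem_ball_zero_iff.1
  have hdetN : ∀ {y : ℂ}, ‖y‖ < 1 → (N y).det ≠ 0 := det_joukowskiPencil_ne_zero hδ hδα hW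
  obtain ⟨q, hq, hp⟩ := exists_inv_joukowskiPencil_eq_div α δ (A - c • 1)
  have hdN : ∀ i j, DifferentiableOn ℂ (fun y => (N y)⁻¹ i j) (ball 0 1) := by
    intro i j
    obtain ⟨p, hp⟩ := hp i j
    refine DifferentiableOn.congr (f := fun y => p.eval y * (q.eval y)⁻¹) ?_ fun y _ => hp y
    refine p.differentiable.differentiableOn.fun_mul
      (q.differentiable.differentiableOn.fun_inv fun y hy => ?_)
    rw [← hq]
    exact hdetN (hball hy)
  have hdP : ∀ i j, DifferentiableOn ℂ (fun y => (α - δ * y ^ 2) * (N y)⁻¹ i j) (ball 0 1) :=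
    fun i j => DifferentiableOn.fun_mul (by fun_prop) (hdN i j)
  have hN0 : (N 0)⁻¹ = (α : ℂ)⁻¹ • 1 := by
    refine Matrix.inv_eq_right_inv ?_
    rw [hN, joukowskiPencil, zero_smul, sub_zero, zero_pow two_ne_zero, mul_zero, add_zero,
      smul_mul_smul_comm, mul_inv_cancel₀ hα, one_smul, one_mul]
  have hP0 : ∀ i, (α - δ * (0 : ℂ) ^ 2) * (N 0)⁻¹ i i = 1 := by
    intro i
    simp [hN0, hα]
  refine norm_le_of_norm_add_conj_le (m := m)
    (f := fun y => (α - δ * y ^ 2) * (N y)⁻¹ k l) (g := fun y => (α - δ * y ^ 2) * (N y)⁻¹ l k)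
    (p := fun y => (α - δ * y ^ 2) * (N y)⁻¹ k k) (q := fun y => (α - δ * y ^ 2) * (N y)⁻¹ l l)
    (h := fun y => (α - δ * y ^ 2) * (((α + δ * y ^ 2) ^ m)⁻¹ *
      ((A - c • 1) ^ m * (N y)⁻¹) k l)) ?_ (hdP l k) ?_ (hdP k k) (hdP l l) ?_ (hP0 k) (hP0 l)
    ?_ hx
  · by_cases hkl : k = l
    · simp [hN0, hkl, hα]
    · simp [hN0, hkl]
  · refine DifferentiableOn.fun_mul (by fun_prop) (DifferentiableOn.fun_mul ?_ ?_)
    · exact DifferentiableOn.fun_inv (by fun_prop) fun y hy =>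
        pow_ne_zero m (add_mul_sq_ne_zero hδ hδα (hball hy))
    · simp only [Matrix.mul_apply]
      exact DifferentiableOn.fun_sum fun j _ => (hdN j l).const_mul _
  · intro y hy
    have h1 := inv_joukowskiPencil_eq_sum (add_mul_sq_ne_zero hδ hδα (hball hy))
      (hdetN (hball hy)) m
    have h2 := congrFun (congrFun h1 k) l
    rw [Matrix.add_apply, Matrix.sum_apply, Finset.sum_eq_zero, zero_add, Matrix.smul_apply,
      smul_eq_mul] at h2
    · simp only [hN]
      conv_lhs => rw [h2]
      ring
    · intro i hi
      rw [Matrix.smul_apply, hm i (Finset.mem_range.1 hi), smul_zero]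
  · intro y hy
    exact norm_add_conj_le_of_re_nonneg
      (re_inv_joukowskiPencil_nonneg hδ hδα hW (hball hy)) k l

theorem smul_one_sub_eq_smul_joukowskiPencil (A : Matrix (Fin n) (Fin n) ℂ) (c : ℂ) {w : ℂ}
    (hw : w ≠ 0) : joukowski α δ c w • (1 : Matrix (Fin n) (Fin n) ℂ) - A
      = w • joukowskiPencil α δ (A - c • 1) w⁻¹ := by
  rw [joukowskiPencil, smul_sub, smul_smul, smul_smul, mul_inv_cancel₀ hw, one_smul, joukowski]
  have : w * (α + δ * w⁻¹ ^ 2) = α * w + δ / w := by field_simp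
  rw [this, add_assoc, add_smul]
  abel

/-- For |w| > 1, ψ(w)I - A is w times an invertible pencil, so ψ(w) is not an eigenvalue. Thus every
preimage of an eigenvalue lies inside each circle of radius r > 1. -/
theorem norm_le_one_of_joukowski_mem_spectrum (hδ : 0 ≤ δ) (hδα : δ < α)
    (hW : ∀ ζ ∈ fieldOfValues A,
      ((ζ.re - c.re) / (α + δ)) ^ 2 + ((ζ.im - c.im) / (α - δ)) ^ 2 ≤ 1)
    {w : ℂ} (hw : w ≠ 0) (hs : joukowski α δ c w ∈ spectrum ℂ A) : ‖w‖ ≤ 1 := by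
  by_contra! h
  have hx : ‖w⁻¹‖ < 1 := by rw [norm_inv]; exact inv_lt_one_of_one_lt₀ h
  have hdet := det_joukowskiPencil_ne_zero hδ hδα hW hx
  rw [spectrum.mem_iff, Algebra.algebraMap_eq_smul_one,
    smul_one_sub_eq_smul_joukowskiPencil A c hw] at hs
  apply hs
  rw [Matrix.isUnit_iff_isUnit_det, det_smul]
  exact (mul_ne_zero (pow_ne_zero _ hw) hdet).isUnit

theorem norm_resolvent_mul_deriv_le (hδ : 0 ≤ δ) (hδα : δ < α)
    (hW : ∀ ζ ∈ fieldOfValues A,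
      ((ζ.re - c.re) / (α + δ)) ^ 2 + ((ζ.im - c.im) / (α - δ)) ^ 2 ≤ 1)
    {k l : Fin n} {m : ℕ} (hm : ∀ i < m, ((A - c • 1) ^ i) k l = 0) {w : ℂ} (hw : 1 < ‖w‖) :
    ‖((joukowski α δ c w • (1 : Matrix (Fin n) (Fin n) ℂ) - A)⁻¹) k l * (α - δ / w ^ 2)‖
      ≤ 2 * (‖w‖⁻¹ ^ m / (1 - ‖w‖⁻¹)) / ‖w‖ := by
  have hw0 : w ≠ 0 := norm_pos_iff.1 (one_pos.trans hw)
  have hx : ‖w⁻¹‖ < 1 := by rw [norm_inv]; exact inv_lt_one_of_one_lt₀ hw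
  have h := norm_inv_joukowskiPencil_le hδ hδα hW hm hx
  have hdet := det_joukowskiPencil_ne_zero hδ hδα hW hx
  have hinv : (joukowski α δ c w • (1 : Matrix (Fin n) (Fin n) ℂ) - A)⁻¹
      = w⁻¹ • (joukowskiPencil α δ (A - c • 1) w⁻¹)⁻¹ := by
    rw [smul_one_sub_eq_smul_joukowskiPencil A c hw0]
    refine Matrix.inv_eq_right_inv ?_
    rw [smul_mul_smul_comm, mul_inv_cancel₀ hw0, one_smul, Matrix.mul_nonsing_inv _ hdet.isUnit]
  have e : ((joukowski α δ c w • (1 : Matrix (Fin n) (Fin n) ℂ) - A)⁻¹) k l * (α - δ / w ^ 2)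
      = ((α - δ * w⁻¹ ^ 2) * ((joukowskiPencil α δ (A - c • 1) w⁻¹)⁻¹) k l) / w := by
    rw [hinv, Matrix.smul_apply, smul_eq_mul]
    field_simp
  rw [e, norm_div]
  rw [norm_inv] at h
  exact div_le_div_of_nonneg_right h (norm_nonneg w)

end Pencil

end

/-! ### The shape of E -/

section

open Complex Metric Set Matrix ComplexConjugate

section ClosedEllipse

variable {a b : ℝ} {c : ℂ} {E : Set ℂ}

/-- A segment is connected, so it cannot pass from the interior of E to the exterior without meeting
the frontier. -/
theorem mem_of_segment_disjoint_frontier {z w : ℂ} (hz : z ∈ E)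
    (h : ∀ x ∈ segment ℝ z w, x ∉ frontier E) : w ∈ E := by
  by_contra hw
  have hcover : segment ℝ z w ⊆ interior E ∪ (closure E)ᶜ := fun x hx => by
    by_cases hxc : x ∈ closure E
    · exact Or.inl (by_contra fun hxi => h x hx ⟨hxc, hxi⟩)
    · exact Or.inr hxc
  have hzl := left_mem_segment ℝ z w
  have hwr := right_mem_segment ℝ z w
  obtain ⟨x, -, hx, hx'⟩ := (convex_segment (𝕜 := ℝ) z w).isPreconnected _ _ isOpen_interior
    isClosed_closure.isOpen_compl hcover
    ⟨z, hzl, (hcover hzl).resolve_right fun hzc => hzc (subset_closure hz)⟩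
    ⟨w, hwr, (hcover hwr).resolve_left fun hwi => hw (interior_subset hwi)⟩
  exact hx' (subset_closure (interior_subset hx))

theorem sq_div_add_sq_div_gt_one {x y x' y' : ℝ} (h : 1 < (x / a) ^ 2 + (y / b) ^ 2)
    (hx : x ^ 2 ≤ x' ^ 2) (hy : y ^ 2 ≤ y' ^ 2) : 1 < (x' / a) ^ 2 + (y' / b) ^ 2 := by
  refine h.trans_le ?_
  simp only [div_pow]
  gcongr

/-- A point of E outside the ellipse could be moved vertically away from c beyond height b, then
horizontally to the imaginary axis. The path stays outside the ellipse, hence in E, contradicting Re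
> 0. -/
theorem ellipse_le_one_of_mem (hb : 0 < b) (hE_right : E ⊆ {z : ℂ | 0 < z.re})
    (hE_boundary : frontier E = ellipseCurve a b c) {z : ℂ} (hz : z ∈ E) :
    ((z.re - c.re) / a) ^ 2 + ((z.im - c.im) / b) ^ 2 ≤ 1 := by
  by_contra! hlt
  have hfront : ∀ x : ℂ, 1 < ((x.re - c.re) / a) ^ 2 + ((x.im - c.im) / b) ^ 2 →
      x ∉ frontier E := by
    intro x hx hxE
    rw [hE_boundary] at hxE
    exact hx.ne' hxE
  have hzre : 0 < z.re := hE_right hz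
  obtain ⟨y, hy1, hy2⟩ : ∃ y : ℝ, b < |y - c.im| ∧
      ∀ θ ∈ Icc (0 : ℝ) 1, (z.im - c.im) ^ 2 ≤ (z.im + θ * (y - z.im) - c.im) ^ 2 := by
    rcases le_total c.im z.im with h | h
    · refine ⟨z.im + b + 1, ?_, fun θ hθ => ?_⟩
      · rw [abs_of_pos] <;> linarith
      · have h1 := mul_nonneg hθ.1 (by linarith : 0 ≤ b + 1)
        refine pow_le_pow_left₀ (by linarith) ?_ 2
        linarith
    · refine ⟨z.im - b - 1, ?_, fun θ hθ => ?_⟩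
      · rw [abs_of_neg] <;> linarith
      · have h1 := mul_nonneg hθ.1 (by linarith : 0 ≤ b + 1)
        rw [← neg_sq, ← neg_sq (z.im + _ - _)]
        refine pow_le_pow_left₀ (by linarith) ?_ 2
        linarith
  have h1 : (⟨z.re, y⟩ : ℂ) ∈ E := by
    refine mem_of_segment_disjoint_frontier hz fun x hx => hfront x ?_
    rw [segment_eq_image'] at hx
    obtain ⟨θ, hθ, rfl⟩ := hx
    refine sq_div_add_sq_div_gt_one hlt ?_ ?_
    · simp
    · simpa using hy2 θ hθ
  have h2 : (⟨0, y⟩ : ℂ) ∈ E := by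
    refine mem_of_segment_disjoint_frontier h1 fun x hx => hfront x ?_
    rw [segment_eq_image'] at hx
    obtain ⟨θ, hθ, rfl⟩ := hx
    have him : ((⟨z.re, y⟩ + θ • ((⟨0, y⟩ : ℂ) - ⟨z.re, y⟩) : ℂ)).im = y := by simp
    have h3 : 1 < ((y - c.im) / b) ^ 2 := by
      rw [div_pow, one_lt_div (by positivity)]
      exact sq_lt_sq.2 (by rwa [abs_of_pos hb])
    simp only [him]
    exact h3.trans_le (le_add_of_nonneg_left (sq_nonneg _))
  have := hE_right h2
  simp at this

theorem lt_re_of_frontier_eq (ha : 0 < a) (hE_closed : IsClosed E)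
    (hE_right : E ⊆ {z : ℂ | 0 < z.re}) (hE_boundary : frontier E = ellipseCurve a b c) :
    a < c.re := by
  have h1 : c - a ∈ frontier E := by
    rw [hE_boundary]
    simp [ellipseCurve, neg_div, div_self ha.ne']
  have h2 := hE_right (hE_closed.frontier_subset h1)
  simpa using h2

end ClosedEllipse

/-! ### The branch of the square root -/

section Sqrt

theorem complex_sqrt_sq (z : ℂ) : z.sqrt ^ 2 = z := by
  simp [Complex.sqrt]

theorem complex_sqrt_re_nonneg (z : ℂ) : 0 ≤ z.sqrt.re := by
  rw [Complex.sqrt, cpow_inv_two_re]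
  exact Real.sqrt_nonneg _

theorem norm_sub_le_norm_add_of_re_nonneg {z w : ℂ} (h : 0 ≤ z.re * w.re + z.im * w.im) :
    ‖z - w‖ ≤ ‖z + w‖ := by
  rw [← sq_le_sq₀ (norm_nonneg _) (norm_nonneg _), ← normSq_eq_norm_sq, ← normSq_eq_norm_sq,
    normSq_apply, normSq_apply]
  simp only [sub_re, sub_im, add_re, add_im]
  nlinarith

/-- For `c` in the right half-plane, the principal square root is the root of `c² - t` on the side
of `c`. -/
theorem norm_sub_sqrt_le {c : ℂ} (hc : 0 < c.re) (t : ℝ) :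
    ‖c - Complex.sqrt (c ^ 2 - t)‖ ≤ ‖c + Complex.sqrt (c ^ 2 - t)‖ := by
  set s := Complex.sqrt (c ^ 2 - t) with hs
  have h1 : s ^ 2 = c ^ 2 - t := complex_sqrt_sq _
  have h2 : 0 ≤ s.re := complex_sqrt_re_nonneg _
  have h3 := congrArg Complex.im h1
  simp only [pow_two, mul_im, sub_im, ofReal_im, sub_zero] at h3
  have h4 : s.re * s.im = c.re * c.im := by linarith
  apply norm_sub_le_norm_add_of_re_nonneg
  have h5 : 0 ≤ c.im * s.im := by
    rcases h2.eq_or_lt with h0 | hpos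
    · rw [← h0, zero_mul] at h4
      rcases mul_eq_zero.1 h4.symm with h | h
      · exact absurd h hc.ne'
      · rw [h, zero_mul]
    · refine nonneg_of_mul_nonneg_right (a := s.re) ?_ hpos
      have : s.re * (c.im * s.im) = c.re * c.im ^ 2 := by linear_combination c.im * h4
      rw [this]; positivity
  have := mul_nonneg hc.le h2
  linarith

/-- The numbers c√(1 - t/c²) and √(c² - t) agree up to sign. If the signs differ, each of |c + s|
and |c - s| bounds the other, so the moduli are equal anyway. -/
theorem norm_add_sqrt_eq {c : ℂ} (hc : 0 < c.re) (t : ℝ) :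
    ‖c + Complex.sqrt (c ^ 2 - t)‖ = ‖c‖ * ‖1 + Complex.sqrt (1 - t / c ^ 2)‖ := by
  have hc0 : c ≠ 0 := by rintro rfl; simp at hc
  set s := Complex.sqrt (c ^ 2 - t) with hs
  set u := Complex.sqrt (1 - t / c ^ 2) with hu
  have h1 : s ^ 2 = c ^ 2 - t := complex_sqrt_sq _
  have h2 : u ^ 2 = 1 - t / c ^ 2 := complex_sqrt_sq _
  have h3 : (c * u) ^ 2 = s ^ 2 := by
    rw [mul_pow, h1, h2]; field_simp
  rw [← norm_mul, mul_add, mul_one]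
  rcases sq_eq_sq_iff_eq_or_eq_neg.1 h3 with h | h
  · rw [h]
  · rw [h, ← sub_eq_add_neg]
    refine le_antisymm ?_ (norm_sub_sqrt_le hc t)
    have h4 : ‖1 - u‖ ≤ ‖1 + u‖ := norm_sub_le_norm_add_of_re_nonneg (by
      have := complex_sqrt_re_nonneg (1 - t / c ^ 2)
      simpa using this)
    have h5 := mul_le_mul_of_nonneg_left h4 (norm_nonneg c)
    rw [← norm_mul, ← norm_mul, mul_sub, mul_add, mul_one, h, sub_neg_eq_add,
      ← sub_eq_add_neg] at h5
    exact h5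

end Sqrt

/-! ### Confocal ellipses and the position of the origin -/

section Confocal

variable {α δ : ℝ} {c : ℂ}

/-- The sum of the distances of `ψ(w)` to the foci. -/
theorem norm_joukowski_sub_focus_add (hα : 0 ≤ α) (hδ : 0 ≤ δ) {w : ℂ} (hw : w ≠ 0) :
    ‖joukowski α δ c w - (c + (2 * (√α * √δ) : ℝ))‖
      + ‖joukowski α δ c w - (c - (2 * (√α * √δ) : ℝ))‖ = 2 * (α * ‖w‖ + δ / ‖w‖) := by
  -- With w = v², the differences to the foci are the squares (√α v ∓ √δ/v)², and the parallelogram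
  -- law adds their moduli.
  obtain ⟨v, hv⟩ := IsAlgClosed.exists_pow_nat_eq w (n := 2) (by norm_num)
  have hv0 : v ≠ 0 := by
    rintro rfl
    exact hw (by rw [← hv]; simp)
  have ha : ((√α : ℝ) : ℂ) ^ 2 = α := by
    rw [← ofReal_pow, Real.sq_sqrt hα]
  have hd : ((√δ : ℝ) : ℂ) ^ 2 = δ := by
    rw [← ofReal_pow, Real.sq_sqrt hδ]
  have e1 : joukowski α δ c w - (c + (2 * (√α * √δ) : ℝ)) = (√α * v - √δ / v) ^ 2 := by
    rw [joukowski, ← hv, ← ha, ← hd]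
    push_cast
    field_simp
    ring
  have e2 : joukowski α δ c w - (c - (2 * (√α * √δ) : ℝ)) = (√α * v + √δ / v) ^ 2 := by
    rw [joukowski, ← hv, ← ha, ← hd]
    push_cast
    field_simp
    ring
  have hpar := parallelogram_law_with_norm ℝ (√α * v : ℂ) (√δ / v)
  rw [e1, e2, norm_pow, norm_pow]
  have n1 : ‖(√α * v : ℂ)‖ * ‖(√α * v : ℂ)‖ = α * ‖w‖ := by
    rw [← norm_mul, show (√α * v : ℂ) * (√α * v) = (√α : ℂ) ^ 2 * v ^ 2 by ring, ha, hv,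
      norm_mul, norm_real, Real.norm_of_nonneg hα]
  have n2 : ‖(√δ / v : ℂ)‖ * ‖(√δ / v : ℂ)‖ = δ / ‖w‖ := by
    rw [← norm_mul, show (√δ / v : ℂ) * (√δ / v) = (√δ : ℂ) ^ 2 / v ^ 2 by ring, hd, hv,
      norm_div, norm_real, Real.norm_of_nonneg hδ]
  rw [← pow_two] at n1 n2
  rw [n1, n2] at hpar
  linarith

variable (α δ c) in
/-- The modulus of the Joukowski parameter of the origin. -/
noncomputable def originRadius : ℝ :=
  ‖c + Complex.sqrt (c ^ 2 - ((4 * (α * δ) : ℝ) : ℂ))‖ / (2 * α)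

theorem focus_sum_eq (hδ : 0 ≤ δ) (hδα : δ < α) (hc : 0 < c.re) :
    0 < originRadius α δ c ∧
    ‖c + (2 * (√α * √δ) : ℝ)‖ + ‖c - (2 * (√α * √δ) : ℝ)‖
      = 2 * (α * originRadius α δ c + δ / originRadius α δ c) := by
  have hα : 0 < α := hδ.trans_lt hδα
  have hα' : (α : ℂ) ≠ 0 := by exact_mod_cast hα.ne'
  set s := Complex.sqrt (c ^ 2 - ((4 * (α * δ) : ℝ) : ℂ)) with hs
  have h1 : s ^ 2 = c ^ 2 - 4 * (α * δ) := by
    have := complex_sqrt_sq (c ^ 2 - ((4 * (α * δ) : ℝ) : ℂ))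
    rw [← hs] at this
    rw [this]; push_cast; ring
  have hcs : c + s ≠ 0 := by
    intro h
    have h2 := congrArg Complex.re h
    have h3 := complex_sqrt_re_nonneg (c ^ 2 - ((4 * (α * δ) : ℝ) : ℂ))
    rw [← hs] at h3
    simp only [add_re, zero_re] at h2
    linarith
  -- This root of αw² + cw + δ = 0 is a preimage of the origin under ψ.
  set w : ℂ := -((c + s) / (2 * α)) with hw
  have hw0 : w ≠ 0 := by
    rw [hw, neg_ne_zero]
    exact div_ne_zero hcs (mul_ne_zero two_ne_zero hα')
  have hnw : ‖w‖ = originRadius α δ c := by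
    rw [hw, norm_neg, norm_div, norm_mul, norm_real, Real.norm_of_nonneg hα.le, originRadius]
    simp [hs]
  have hψ : joukowski α δ c w = 0 := by
    rw [joukowski, hw]
    field_simp
    linear_combination -h1
  have h2 := norm_joukowski_sub_focus_add (c := c) hα.le hδ hw0
  rw [hψ, zero_sub, zero_sub, norm_neg, norm_neg, hnw] at h2
  exact ⟨hnw ▸ norm_pos_iff.2 hw0, h2⟩

theorem one_lt_originRadius (hδ : 0 ≤ δ) (hδα : δ < α) (hc : α + δ < c.re) :
    1 < originRadius α δ c := by
  have hα : 0 < α := hδ.trans_lt hδα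
  have hc0 : 0 < c.re := by linarith
  obtain ⟨hpos, hsum⟩ := focus_sum_eq hδ hδα hc0
  set τ := originRadius α δ c with hτ
  have h1 := re_le_norm (c + (2 * (√α * √δ) : ℝ))
  have h2 := re_le_norm (c - (2 * (√α * √δ) : ℝ))
  simp only [add_re, sub_re, ofReal_re] at h1 h2
  -- This leaves τ > 1 or τ < δ/α. The bound δ ≤ ατ² below says that τ belongs to the larger root
  -- and excludes the second case.
  have h3 : α + δ < α * τ + δ / τ := by linarith
  have h4 : δ ≤ α * τ ^ 2 := by
    set s := Complex.sqrt (c ^ 2 - ((4 * (α * δ) : ℝ) : ℂ)) with hs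
    have e1 : s ^ 2 = c ^ 2 - ((4 * (α * δ) : ℝ) : ℂ) := complex_sqrt_sq _
    have e2 : ‖c - s‖ * ‖c + s‖ = 4 * (α * δ) := by
      rw [← norm_mul, show (c - s) * (c + s) = ((4 * (α * δ) : ℝ) : ℂ) by
        linear_combination -e1, norm_real, Real.norm_of_nonneg (by positivity)]
    have e3 := mul_le_mul_of_nonneg_right (norm_sub_sqrt_le hc0 (4 * (α * δ)))
      (norm_nonneg (c + s))
    rw [← hs, e2] at e3
    have e4 : ‖c + s‖ = 2 * α * τ := by
      rw [hτ, originRadius, mul_div_cancel₀ _ (by positivity)]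
    rw [e4] at e3
    have : α * δ ≤ α * (α * τ ^ 2) := by nlinarith
    exact le_of_mul_le_mul_left this hα
  by_contra! hle
  have h5 : (α + δ) * τ < α * τ ^ 2 + δ := by
    have := mul_lt_mul_of_pos_right h3 hpos
    rw [add_mul (α * τ), div_mul_cancel₀ _ hpos.ne'] at this
    linarith
  have h6 : α * τ ^ 2 ≤ α * τ :=
    mul_le_mul_of_nonneg_left (pow_le_of_le_one hpos.le hle two_ne_zero) hα.le
  have h7 := mul_nonneg (sub_nonneg.2 (h4.trans h6)) (sub_nonneg.2 hle)
  linarith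

theorem norm_le_norm_neg_ofReal_sub {t : ℝ} (ht : t ≤ 0) {f : ℂ} (hf : 0 ≤ f.re) :
    ‖f‖ ≤ ‖(t : ℂ) - f‖ := by
  rw [← sq_le_sq₀ (norm_nonneg _) (norm_nonneg _), ← normSq_eq_norm_sq, ← normSq_eq_norm_sq,
    normSq_apply, normSq_apply]
  simp only [sub_re, sub_im, ofReal_re, ofReal_im]
  nlinarith [mul_nonneg (neg_nonneg.2 ht) hf]

/-- Both foci have positive real part, so a point t ≤ 0 has focal distance sum at least that of the
origin. But r ↦ αr + δ/r is increasing for r ≥ 1, and |w| < τ puts ψ(w) on a strictly smaller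
confocal ellipse. -/
theorem joukowski_mem_slitPlane (hδ : 0 ≤ δ) (hδα : δ < α) (hc : α + δ < c.re) {w : ℂ}
    (hw1 : 1 < ‖w‖) (hw2 : ‖w‖ < originRadius α δ c) : joukowski α δ c w ∈ slitPlane := by
  have hα : 0 < α := hδ.trans_lt hδα
  obtain ⟨hpos, hsum⟩ := focus_sum_eq hδ hδα (by linarith : 0 < c.re)
  set τ := originRadius α δ c with hτ
  have hw0 : w ≠ 0 := norm_pos_iff.1 (one_pos.trans hw1)
  by_contra hmem
  rw [mem_slitPlane_iff_not_le_zero, not_not] at hmem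
  obtain ⟨t, ht, htw⟩ : ∃ t : ℝ, t ≤ 0 ∧ joukowski α δ c w = t := by
    refine ⟨(joukowski α δ c w).re, (le_def.1 hmem).1, ?_⟩
    apply Complex.ext
    · simp
    · simpa using (le_def.1 hmem).2
  have hf := norm_joukowski_sub_focus_add (c := c) hα.le hδ hw0
  rw [htw] at hf
  have hρ : 2 * (√α * √δ) ≤ α + δ := by
    have := two_mul_le_add_sq √α √δ
    rw [Real.sq_sqrt hα.le, Real.sq_sqrt hδ] at this
    linarith
  have hρ0 : 0 ≤ 2 * (√α * √δ) := by positivity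
  have f1 := norm_le_norm_neg_ofReal_sub ht (f := c + (2 * (√α * √δ) : ℝ))
    (by rw [add_re, ofReal_re]; linarith)
  have f2 := norm_le_norm_neg_ofReal_sub ht (f := c - (2 * (√α * √δ) : ℝ))
    (by rw [sub_re, ofReal_re]; linarith)
  have h1 : α * τ + δ / τ ≤ α * ‖w‖ + δ / ‖w‖ := by linarith
  set r := ‖w‖ with hr
  have hr0 : 0 < r := one_pos.trans hw1
  have h2 : (α * τ + δ / τ) - (α * r + δ / r) = (τ - r) * (α - δ / (r * τ)) := by
    field_simp
    ring
  have h3 : δ / (r * τ) < α := by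
    rw [div_lt_iff₀ (by positivity)]
    have : 1 < r * τ := by nlinarith
    nlinarith
  have h4 := mul_pos (sub_pos.2 hw2) (sub_pos.2 h3)
  linarith

end Confocal

/-! ### The bound on a circle and its limit -/

section Main

theorem differentiableOn_expNegSqrt : DifferentiableOn ℂ expNegSqrt slitPlane := by
  intro z hz
  have : DifferentiableAt ℂ (fun z : ℂ => exp (-(z ^ (2⁻¹ : ℂ)))) z :=
    ((differentiableAt_id.cpow_const hz).neg).cexp
  exact this.differentiableWithinAt

theorem norm_expNegSqrt_le_one (z : ℂ) : ‖expNegSqrt z‖ ≤ 1 := by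
  rw [expNegSqrt, norm_exp, Real.exp_le_one_iff, neg_re, neg_nonpos]
  exact complex_sqrt_re_nonneg z

theorem spectrum_subset_fieldOfValues {n : ℕ} (A : Matrix (Fin n) (Fin n) ℂ) :
    spectrum ℂ A ⊆ fieldOfValues A := by
  intro z hz
  rw [spectrum.mem_iff, Algebra.algebraMap_eq_smul_one, Matrix.isUnit_iff_isUnit_det,
    isUnit_iff_ne_zero, not_not] at hz
  obtain ⟨v, hv, hv0⟩ := Matrix.exists_mulVec_eq_zero_iff.2 hz
  rw [sub_mulVec, smul_mulVec, one_mulVec, sub_eq_zero] at hv0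
  obtain ⟨t, ht, htv, ζ, hζ, hAv⟩ := fieldOfValues_smul_mem (A := A) hv
  rw [← hv0, dotProduct_smul, htv, smul_eq_mul, mul_comm] at hAv
  have ht' : (t : ℂ) ≠ 0 := by exact_mod_cast ht.ne'
  rwa [mul_left_cancel₀ ht' hAv]

theorem norm_matrixFunction_expNegSqrt_le_of_lt {n : ℕ} {A : Matrix (Fin n) (Fin n) ℂ}
    {α δ r : ℝ} {c : ℂ} (hδ : 0 ≤ δ) (hδα : δ < α) (hc : α + δ < c.re)
    (hW : ∀ ζ ∈ fieldOfValues A,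
      ((ζ.re - c.re) / (α + δ)) ^ 2 + ((ζ.im - c.im) / (α - δ)) ^ 2 ≤ 1)
    (hA : fieldOfValues A ⊆ slitPlane) (Γ : Contour slitPlane A) {k l : Fin n} {m : ℕ}
    (hm : ∀ i < m, ((A - c • 1) ^ i) k l = 0) (hr : 1 < r) (hr' : r < originRadius α δ c) :
    ‖matrixFunction expNegSqrt A Γ k l‖ ≤ 2 * (r⁻¹ ^ m / (1 - r⁻¹)) := by
  have hr0 : 0 < r := one_pos.trans hr
  have hα : α ≠ 0 := (hδ.trans_lt hδα).ne'
  have hsp := fun {w : ℂ} => norm_le_one_of_joukowski_mem_spectrum (w := w) hδ hδα hW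
  rw [matrixFunction_apply_eq_ellipseIntegral (α := α) (δ := δ) (c := c) Γ hr0 hα
    ((spectrum_subset_fieldOfValues A).trans hA) ?_ ?_ differentiableOn_expNegSqrt k l,
    ellipseIntegral, ← smul_eq_mul]
  -- The factor 1/r in the constant cancels the radius from the length of the circle.
  · refine (circleIntegral.norm_two_pi_i_inv_smul_integral_le_of_norm_le_const
      (C := 2 * (r⁻¹ ^ m / (1 - r⁻¹)) / r) hr0.le fun w hw => ?_).trans_eq
      (mul_div_cancel₀ _ hr0.ne')
    have hwr : ‖w‖ = r := mem_sphere_zero_iff_norm.1 hw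
    have h := norm_resolvent_mul_deriv_le hδ hδα hW hm (w := w) (by rw [hwr]; exact hr)
    rw [hwr] at h
    rw [mul_assoc, norm_mul]
    exact (mul_le_of_le_one_left (norm_nonneg _) (norm_expNegSqrt_le_one _)).trans h
  · intro w hw
    have hwr : ‖w‖ = r := mem_sphere_zero_iff_norm.1 hw
    refine ⟨joukowski_mem_slitPlane hδ hδα hc (by rw [hwr]; exact hr) (by rw [hwr]; exact hr'),
      fun hs => ?_⟩
    have := hsp (sphere_zero_ne_zero hr0 hw) hs
    linarith
  · intro z hz w hw hwz
    exact (hsp hw (by rw [hwz]; exact hz)).trans_lt hr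

/-- The circle of radius τ itself may meet the branch point 0, so the bound is reached as r tends to
τ from below. -/
theorem norm_matrixFunction_expNegSqrt_le {n : ℕ} {A : Matrix (Fin n) (Fin n) ℂ}
    {α δ : ℝ} {c : ℂ} (hδ : 0 ≤ δ) (hδα : δ < α) (hc : α + δ < c.re)
    (hW : ∀ ζ ∈ fieldOfValues A,
      ((ζ.re - c.re) / (α + δ)) ^ 2 + ((ζ.im - c.im) / (α - δ)) ^ 2 ≤ 1)
    (hA : fieldOfValues A ⊆ slitPlane) (Γ : Contour slitPlane A) {k l : Fin n} {m : ℕ}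
    (hm : ∀ i < m, ((A - c • 1) ^ i) k l = 0) :
    ‖matrixFunction expNegSqrt A Γ k l‖
      ≤ 2 * ((originRadius α δ c)⁻¹ ^ m / (1 - (originRadius α δ c)⁻¹)) := by
  have hτ := one_lt_originRadius hδ hδα hc
  set τ := originRadius α δ c with hτdef
  have hτ0 : τ ≠ 0 := (one_pos.trans hτ).ne'
  have hcont : ContinuousAt (fun r : ℝ => 2 * (r⁻¹ ^ m / (1 - r⁻¹))) τ := by
    have hinv : ContinuousAt (fun r : ℝ => r⁻¹) τ := continuousAt_inv₀ hτ0
    refine ContinuousAt.mul continuousAt_const (ContinuousAt.div (hinv.pow m)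
      (continuousAt_const.sub hinv) ?_)
    exact (sub_pos.2 (inv_lt_one_of_one_lt₀ hτ)).ne'
  refine ge_of_tendsto (hcont.tendsto.mono_left (nhdsWithin_le_nhds (s := Iio τ))) ?_
  filter_upwards [Ioo_mem_nhdsLT hτ] with r hr
  exact norm_matrixFunction_expNegSqrt_le_of_lt hδ hδα hc hW hA Γ hm hr.1 hr.2

end Main

end

theorem corollary3p5 {n : ℕ} (β γ : ℕ) (hβ : β ≠ 0) (hγ : γ ≠ 0)
    (A : Matrix (Fin n) (Fin n) ℂ) (hA : IsBanded β γ A)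
    (a b : ℝ) (hb : 0 < b) (hab : b ≤ a) (c : ℂ)
    (E : Set ℂ) (hE_closed : IsClosed E) (hE_right : E ⊆ {z : ℂ | 0 < z.re})
    (hE_boundary : frontier E = ellipseCurve a b c) (hAE : fieldOfValues A ⊆ E)
    (Γ : Contour Complex.slitPlane A) (k l : Fin n) :
    ‖matrixFunction expNegSqrt A Γ k l‖ ≤
      2 * q2 a b c 0 *
        ((a + b) / ‖c‖ *
          (1 / ‖1 + Complex.sqrt (1 - ((a : ℂ) ^ 2 - (b : ℂ) ^ 2) / c ^ 2)‖)) ^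
            bandExponent β γ k l := by
  -- These values make ψ map the unit circle to the given ellipse: α + δ = a, α - δ = b and 4αδ = a²
  -- - b².
  set α : ℝ := (a + b) / 2 with hα
  set δ : ℝ := (a - b) / 2 with hδdef
  have hδ : 0 ≤ δ := by rw [hδdef]; linarith
  have hδα : δ < α := by rw [hδdef, hα]; linarith
  have hsum : α + δ = a := by rw [hδdef, hα]; ring
  have hdiff : α - δ = b := by rw [hδdef, hα]; ring
  have hac := lt_re_of_frontier_eq (hb.trans_le hab) hE_closed hE_right hE_boundary
  have hc : α + δ < c.re := by rwa [hsum]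
  have hc0 : 0 < c.re := (hb.trans_le hab).trans hac
  have hW : ∀ ζ ∈ fieldOfValues A,
      ((ζ.re - c.re) / (α + δ)) ^ 2 + ((ζ.im - c.im) / (α - δ)) ^ 2 ≤ 1 := by
    rw [hsum, hdiff]
    exact fun ζ hζ => ellipse_le_one_of_mem hb hE_right hE_boundary (hAE hζ)
  have hslit : fieldOfValues A ⊆ Complex.slitPlane := fun z hz =>
    Complex.mem_slitPlane_iff.2 (Or.inl (hE_right (hAE hz)))
  have h := norm_matrixFunction_expNegSqrt_le hδ hδα hc hW hslit Γ (k := k) (l := l)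
    (m := bandExponent β γ k l) fun i hi => (hA.sub_smul_one c).pow_apply_eq_zero hβ hγ hi
  have hτ := one_lt_originRadius hδ hδα hc
  have hab0 : 0 < a + b := by linarith
  have hfoc : ((4 * (α * δ) : ℝ) : ℂ) = (a : ℂ) ^ 2 - (b : ℂ) ^ 2 := by
    rw [hα, hδdef]; push_cast; ring
  have hmod : q2Modulus a b c 0 = originRadius α δ c * (a + b) := by
    rw [originRadius, hfoc, show 2 * α = a + b by rw [hα]; ring, div_mul_cancel₀ _ hab0.ne',
      q2Modulus]
    simp
  have hmod' : ‖c‖ * ‖1 + Complex.sqrt (1 - ((a : ℂ) ^ 2 - (b : ℂ) ^ 2) / c ^ 2)‖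
      = originRadius α δ c * (a + b) := by
    rw [← hfoc, ← norm_add_sqrt_eq hc0, originRadius, show 2 * α = a + b by rw [hα]; ring,
      div_mul_cancel₀ _ hab0.ne']
  set τ := originRadius α δ c with hτdef
  have hτ0 : 0 < τ := one_pos.trans hτ
  have hτ1 : τ - 1 ≠ 0 := (sub_pos.2 hτ).ne'
  have hbase : (a + b) / ‖c‖ *
      (1 / ‖1 + Complex.sqrt (1 - ((a : ℂ) ^ 2 - (b : ℂ) ^ 2) / c ^ 2)‖) = τ⁻¹ := by
    rw [div_mul_div_comm, mul_one, hmod', div_mul_cancel_right₀ hab0.ne']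
  have hq2 : q2 a b c 0 = (1 - τ⁻¹)⁻¹ := by
    rw [q2, hmod, ← sub_one_mul, mul_div_mul_right _ _ hab0.ne', ← one_div τ,
      one_sub_div hτ0.ne', inv_div]
  rw [hbase, hq2]
  refine h.trans_eq ?_
  rw [div_eq_mul_inv]; ring
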